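/- Let $g \ge 2$ be an integer. For $k \ge 0$ put $d = \binom{k}{2}(g-1)$ and index the coordinates of $\mathbb{R}^d$ by the pairs $(\{i,j\},a)$ with $1 \le i < j \le k$ and $a \in \mathbb{Z}_g \setminus \{0\}$. For $x \in (\mathbb{Z}_g)^k$ let $Z(x) \in \mathbb{R}^d$ be the vector whose coordinate $(\{i,j\},a)$, $i<j$, is $1 - 1/g$ if $x_i - x_j = a$ and $-1/g$ otherwise. Let $X_t$ be the random walk on $\mathbb{R}^d$ started at $0$ whose increments are independent and uniformly distributed on the set $\{Z(x) : x \in (\mathbb{Z}_g)^k\}$. Let $M$ be the $d \times d$ matrix whose entry in position $((\{i,j\},a),(\{m,n\},b))$ is $\frac{g-1}{g^2}$ if $\{i,j\}=\{m,n\}$ and $a=b$, is $-\frac{1}{g^2}$ if $\{i,j\}=\{m,n\}$ and $a \ne b$, and is $0$ if $\{i,j\}\neq\{m,n\}$. Call positive reals $D_1, D_2$ admissible for $(g,k)$ if there is a real symmetric matrix $P$ with $P^2 = M$ and \[ [-D_1\delta, D_1\delta]^d \subseteq P[-\delta,\delta]^d \subseteq [-D_2\delta, D_2\delta]^d \quad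 \text{for all } \delta > 0 . \] **Theorem.** (a) There are $D_1, D_2 > 0$, depending only on $g$, that are admissible for $(g,k)$ for every $k$. (b) Let $k \ge 2$ and let $D_1, D_2$ be admissible for $(g,k)$. Put \[ L = \left[1 + t^2(d\delta)^6\right]^{-1/2}\left[1 - \tfrac13 (d\delta)^4\right]^t\left[1 - e^{-\frac t2 (D_1\delta)^2}\right]^{d/2}, \] \[ U = \left[1 + \tfrac14 (d\delta)^6\right]^{t/2}\left[1 + \tfrac13 (d\delta)^4\right]^t\left[1 - e^{-t (D_2\delta)^2}\right]^{d/2}. \] Suppose that $0 < \delta < \frac85 g^{-k-3}k^{-2}$, and let $t$ be a positive integer multiple of $g$ with $t < 2(d\delta)^{-3}$. If $g$ is odd, or if $g$ and $t/g$ are both even, then \[ \mathbb{P}(X_t = 0) \le \frac{g^{\frac g2\binom k2 + \binom{k-1}{2}}}{\sqrt{(2\pi t)^d}}\, U + \exp\left(-\tfrac{11}{192} g^{-k} t \delta^2\right) \] and \[ \mathbb{P}(X_t = 0) \ge \frac{g^{\frac g2\binom k2 + \binom{k-1}{2}}}{\sqrt{(2\pi t)^d}}\, L - \exp\left(-\tfrac{11}{192}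 g^{-k} t \delta^2\right). \] -/

import Mathlib

open MeasureTheory ProbabilityTheory

noncomputable section

namespace DiffMatrixWalk

/-- The coordinates of the Euclidean space: a pair of rows `i < j` and a nonzero residue. -/
abbrev Idx (g k : ℕ) : Type :=
  {p : Fin k × Fin k // p.1 < p.2} × {a : ZMod g // a ≠ 0}

/-- The vector `Z(x)`, for a column `x` with entries in `ZMod g`. -/
def Z (g k : ℕ) (x : Fin k → ZMod g) : Idx g k → ℝ := fun c =>
  if x c.1.1.1 - x c.1.1.2 = c.2.1 then 1 - 1 / (g : ℝ) else -(1 / (g : ℝ))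

/-- The random vectors `ξ 0, ξ 1, …` are independent, and each of them is uniformly distributed
on the finite set of all `Z(x)`. -/
structure IsStepSequence (g k : ℕ) {Ω : Type*} [MeasurableSpace Ω] (μ : Measure Ω)
    (ξ : ℕ → Ω → Idx g k → ℝ) : Prop where
  law : ∀ n, HasLaw (ξ n) (uniformOn (Set.range (Z g k))) μ
  indep : iIndepFun ξ μ

/-- The random walk started at the origin with increments `ξ 0, ξ 1, …`. -/
def walk {g k : ℕ} {Ω : Type*} (ξ : ℕ → Ω → Idx g k → ℝ) (t : ℕ) (ω : Ω) : Idx g k → ℝ :=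
  ∑ n ∈ Finset.range t, ξ n ω

/-- The dimension `d`, that is, the number of coordinates. -/
def dim (g k : ℕ) : ℕ := k.choose 2 * (g - 1)

/-- The covariance matrix of one step of the walk. -/
def covMatrix (g k : ℕ) : Matrix (Idx g k) (Idx g k) ℝ := fun r s =>
  if r.1 = s.1 then
    if r.2 = s.2 then ((g : ℝ) - 1) / (g : ℝ) ^ 2 else -(1 / (g : ℝ) ^ 2)
  else 0

/-- The cube `[-r, r]^d`. -/
def cube (g k : ℕ) (r : ℝ) : Set (Idx g k → ℝ) := {θ | ∀ c, θ c ∈ Set.Icc (-r) r}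

/-- `D₁` and `D₂` are positive constants such that, for some symmetric square root `P` of the
covariance matrix, `[-D₁ δ, D₁ δ]^d ⊆ P [-δ, δ]^d ⊆ [-D₂ δ, D₂ δ]^d` for all `δ > 0`. -/
def CubeConstants (g k : ℕ) [NeZero g] (D₁ D₂ : ℝ) : Prop :=
  0 < D₁ ∧ 0 < D₂ ∧
    ∃ P : Matrix (Idx g k) (Idx g k) ℝ, P.IsSymm ∧ P * P = covMatrix g k ∧
      ∀ δ : ℝ, 0 < δ →
        cube g k (D₁ * δ) ⊆ P.mulVec '' cube g k δ ∧
          P.mulVec '' cube g k δ ⊆ cube g k (D₂ * δ)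

/-- The factor in the lower bound. -/
def lowerFactor (D₁ : ℝ) (g k t : ℕ) (δ : ℝ) : ℝ :=
  (1 + (t : ℝ) ^ 2 * ((dim g k : ℝ) * δ) ^ 6) ^ (-(1 / 2) : ℝ) *
    (1 - 1 / 3 * ((dim g k : ℝ) * δ) ^ 4) ^ t *
    (1 - Real.exp (-((t : ℝ) / 2) * (D₁ * δ) ^ 2)) ^ ((dim g k : ℝ) / 2)

/-- The factor in the upper bound. -/
def upperFactor (D₂ : ℝ) (g k t : ℕ) (δ : ℝ) : ℝ :=
  (1 + 1 / 4 * ((dim g k : ℝ) * δ) ^ 6) ^ ((t : ℝ) / 2) *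
    (1 + 1 / 3 * ((dim g k : ℝ) * δ) ^ 4) ^ t *
    (1 - Real.exp (-(t : ℝ) * (D₂ * δ) ^ 2)) ^ ((dim g k : ℝ) / 2)

/-- The main term `g ^ ((g / 2) * (k choose 2) + (k - 1 choose 2)) / √((2 π t) ^ d)`. -/
def mainTerm (g k t : ℕ) : ℝ :=
  (g : ℝ) ^ ((g : ℝ) / 2 * (k.choose 2 : ℝ) + ((k - 1).choose 2 : ℝ)) /
    Real.sqrt ((2 * Real.pi * (t : ℝ)) ^ dim g k)

/-- The error term `exp (-(11 / 192) g ^ (-k) t δ ^ 2)`. -/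
def errorTerm (g k t : ℕ) (δ : ℝ) : ℝ :=
  Real.exp (-(11 / 192) * (g : ℝ) ^ (-(k : ℤ)) * (t : ℝ) * δ ^ 2)

end DiffMatrixWalk

end

/-! The proof is Fourier inversion followed by a Laplace estimate. When `g` divides `t`, the walk at
time `t` lies in the integer lattice, so (2π)^d P(X_t = 0) is the integral of φ^t over a period box,
where φ = `stepChar` is the characteristic function of one step (`prob_walk_eq_zero`).

Where is |φ| close to 1? Up to a constant, θ·Z(x) is a sum of functions of the differences x_i -
x_j, one for each pair (`dotProduct_Z`). If it is nearly constant modulo 2π, a mixed second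
difference isolates one pair and shows that its function is nearly additive on `ZMod g`. A cocycle
averaging argument then puts it near a character. So θ is near a peak given by a family of residues
c_p with ∑ c_p (x_i - x_j) = 0 for all x (`exists_peak_near`), and there are g^C(k-1,2) such
families (`card_peakIndex`). Away from the peaks two columns have phases that differ noticeably
modulo 2π, which costs a definite amount in |φ| (`norm_stepChar_pow_le`). This gives the exponential
error.

Translation by a peak multiplies φ by a unimodular constant whose t-th power is 1 under the parity
hypothesis (`stepChar_peak_add_pow`), so all peaks contribute the same integral over a cube at the
origin. There Z(x) has mean zero and covariance M, so φ^t is compared with exp(-t θ·Mθ/2)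
(`stepChar_near`, `integral_cube_bounds`). The substitution y = Pθ with P² = M turns this into a
standard Gaussian over P[-δ,δ]^d, which is sandwiched between two cubes. Integrals over cubes are
estimated by discs in the plane (`gaussian_integral_bounds`). The factor |det P|⁻¹ supplies the
power g^{(g/2) C(k,2)}. -/

namespace DiffMatrixWalk

/-! ### Mean and covariance of one step -/

section Covariance

variable {g k : ℕ} [NeZero g]

omit [NeZero g] in
lemma Z_add (v : Fin k → ZMod g) (c : Idx g k) (hv : v c.1.1.1 - v c.1.1.2 = 1)
    (x : Fin k → ZMod g) (s : ZMod g) :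
    Z g k (x + s • v) c =
      (if s = c.2.1 - (x c.1.1.1 - x c.1.1.2) then 1 else 0) - 1 / (g : ℝ) := by
  have h : ((x + s • v) c.1.1.1 - (x + s • v) c.1.1.2 = c.2.1) ↔
      s = c.2.1 - (x c.1.1.1 - x c.1.1.2) := by
    have h1 : (x + s • v) c.1.1.1 - (x + s • v) c.1.1.2 = x c.1.1.1 - x c.1.1.2 + s := by
      simp only [Pi.add_apply, Pi.smul_apply, smul_eq_mul]
      linear_combination s * hv
    rw [h1]
    constructor <;> intro h2
    · rw [← h2]; ring
    · rw [h2]; ring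
  unfold Z
  simp only [h]
  split_ifs <;> ring

/-- A coordinate of `Z` is orthogonal to every function that is invariant under a shift
moving the corresponding difference by one. -/
lemma sum_Z_mul_eq_zero (v : Fin k → ZMod g) (c : Idx g k) (hv : v c.1.1.1 - v c.1.1.2 = 1)
    (H : (Fin k → ZMod g) → ℝ) (hH : ∀ x (s : ZMod g), H (x + s • v) = H x) :
    ∑ x, Z g k x c * H x = 0 := by
  have hg : (g : ℝ) ≠ 0 := Nat.cast_ne_zero.2 (NeZero.ne g)
  -- The sum is the same after each shift by `s • v`. Summed over all `s`, the coordinate cancels: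
  -- it equals `1 - 1/g` once and `-1/g` for the other `g - 1` shifts.
  have h1 : ∀ s : ZMod g, ∑ x, Z g k x c * H x = ∑ x, Z g k (x + s • v) c * H x := by
    intro s
    rw [← Equiv.sum_comp (Equiv.addRight (s • v))]
    simp [hH]
  have h2 : ∑ _s : ZMod g, ∑ x, Z g k x c * H x = 0 := by
    rw [Finset.sum_congr rfl fun s _ => h1 s, Finset.sum_comm]
    refine Finset.sum_eq_zero fun x _ => ?_
    rw [← Finset.sum_mul]
    simp only [Z_add v c hv, Finset.sum_sub_distrib, Finset.sum_ite_eq', Finset.mem_univ, if_true,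
      Finset.sum_const, Finset.card_univ, ZMod.card, nsmul_eq_mul]
    rw [mul_one_div_cancel hg]; simp
  simpa [hg] using h2

lemma sum_Z (c : Idx g k) : ∑ x, Z g k x c = 0 := by
  have h := sum_Z_mul_eq_zero (Pi.single c.1.1.1 1) c
    (by simp [(c.1.2).ne']) (fun _ => 1) (fun _ _ => rfl)
  simpa using h

-- Two distinct pairs share at most one row, so some row of `p` lies outside `q`, and moving that
-- row alone changes only the difference of `p`. This makes coordinates of different pairs
-- uncorrelated.
omit [NeZero g] in
lemma exists_shift {p q : {p : Fin k × Fin k // p.1 < p.2}} (hpq : p ≠ q) :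
    ∃ v : Fin k → ZMod g, v p.1.1 - v p.1.2 = 1 ∧ v q.1.1 = v q.1.2 := by
  obtain ⟨⟨i, j⟩, hij⟩ := p
  obtain ⟨⟨m, n⟩, hmn⟩ := q
  simp only at hij hmn ⊢
  by_cases h1 : i ≠ m ∧ i ≠ n
  · exact ⟨Pi.single i 1, by simp [hij.ne'],
      by simp [h1.1.symm, h1.2.symm]⟩
  · refine ⟨-Pi.single j 1, by simp [hij.ne], ?_⟩
    have h2 : j ≠ m ∧ j ≠ n := by
      constructor
      · rintro rfl
        simp only [ne_eq, not_and_or, not_not] at h1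
        rcases h1 with rfl | rfl
        · exact lt_irrefl _ hij
        · exact lt_asymm hij hmn
      · rintro rfl
        simp only [ne_eq, not_and_or, not_not] at h1
        rcases h1 with rfl | rfl
        · exact hpq rfl
        · exact lt_irrefl _ hij
    simp [h2.1.symm, h2.2.symm]

/-- `covMatrix` is the covariance matrix of `Z x` for uniformly distributed `x`. -/
lemma sum_Z_mul_Z (c c' : Idx g k) :
    ∑ x, Z g k x c * Z g k x c' = (g : ℝ) ^ k * covMatrix g k c c' := by
  have hg : (g : ℝ) ≠ 0 := Nat.cast_ne_zero.2 (NeZero.ne g)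
  unfold covMatrix
  by_cases h : c.1 = c'.1
  · have hcard : ∑ _x : Fin k → ZMod g, (1 : ℝ) = (g : ℝ) ^ k := by simp
    rw [if_pos h]
    by_cases h2 : c.2 = c'.2
    · rw [if_pos h2]
      obtain rfl : c = c' := Prod.ext h h2
      -- The coordinate takes only two values, so its square is an affine function of it.
      have h3 : ∀ x, Z g k x c * Z g k x c =
          (1 - 2 / g) * Z g k x c + ((g : ℝ) - 1) / g ^ 2 * 1 := by
        intro x; unfold Z; split_ifs <;> field_simp <;> ring
      rw [Finset.sum_congr rfl fun x _ => h3 x, Finset.sum_add_distrib, ← Finset.mul_sum,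
        ← Finset.mul_sum, sum_Z, hcard]
      ring
    · rw [if_neg h2]
      have h4 : c.2.1 ≠ c'.2.1 := fun h5 => h2 (Subtype.ext h5)
      -- A difference cannot equal two residues at once, so at most one of the factors is `1 - 1/g`
      -- and the product is affine in the factors.
      have h3 : ∀ x, Z g k x c * Z g k x c' =
          (-1 / g) * Z g k x c + (-1 / g) * Z g k x c' + -(1 / (g : ℝ) ^ 2) * 1 := by
        intro x; unfold Z; rw [← h]
        split_ifs with h5 h6
        · exact absurd (h5.symm.trans h6) h4
        all_goals field_simp; ring
      rw [Finset.sum_congr rfl fun x _ => h3 x, Finset.sum_add_distrib, Finset.sum_add_distrib,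
        ← Finset.mul_sum, ← Finset.mul_sum, ← Finset.mul_sum, sum_Z, sum_Z, hcard]
      ring
  · rw [if_neg h, mul_zero]
    obtain ⟨v, hv, hv'⟩ := exists_shift (g := g) h
    refine sum_Z_mul_eq_zero v c hv _ fun x s => ?_
    simp [Z, hv']

lemma sum_dotProduct_Z (θ : Idx g k → ℝ) : ∑ x, θ ⬝ᵥ Z g k x = 0 := by
  simp only [dotProduct]
  rw [Finset.sum_comm]
  refine Finset.sum_eq_zero fun c _ => ?_
  rw [← Finset.mul_sum, sum_Z, mul_zero]

lemma sum_dotProduct_Z_sq (θ : Idx g k → ℝ) :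
    ∑ x, (θ ⬝ᵥ Z g k x) ^ 2 = (g : ℝ) ^ k * (θ ⬝ᵥ (covMatrix g k).mulVec θ) := by
  simp only [dotProduct, Matrix.mulVec, sq, Finset.sum_mul_sum]
  rw [Finset.sum_comm, Finset.mul_sum]
  refine Finset.sum_congr rfl fun c _ => ?_
  rw [Finset.sum_comm, Finset.mul_sum, Finset.mul_sum]
  refine Finset.sum_congr rfl fun c' _ => ?_
  rw [Finset.sum_congr rfl (g := fun x => θ c * θ c' * (Z g k x c * Z g k x c'))
    (fun x _ => by ring), ← Finset.mul_sum, sum_Z_mul_Z]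
  ring

lemma abs_Z_le (x : Fin k → ZMod g) (c : Idx g k) : |Z g k x c| ≤ 1 := by
  have hg : (1 : ℝ) ≤ g := by exact_mod_cast NeZero.one_le
  have h1 : 1 / (g : ℝ) ≤ 1 := by rw [div_le_one (by linarith)]; exact hg
  have h0 : 0 ≤ 1 / (g : ℝ) := by positivity
  unfold Z
  split_ifs <;> rw [abs_le] <;> constructor <;> linarith

lemma card_pairs (k : ℕ) : Fintype.card {p : Fin k × Fin k // p.1 < p.2} = k.choose 2 := by
  rw [Fintype.card_subtype]
  have h := Fintype.card_finset_len (α := Fin k) 2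
  rw [Fintype.card_fin, Fintype.card_subtype] at h
  rw [← h]
  refine Finset.card_bij (fun p _ => {p.1, p.2}) ?_ ?_ ?_
  · intro p hp
    simp only [Finset.mem_filter, Finset.mem_univ, true_and] at hp ⊢
    exact Finset.card_pair hp.ne
  · rintro ⟨a, b⟩ hp ⟨a', b'⟩ hq hpq
    simp only [Finset.mem_filter, Finset.mem_univ, true_and] at hp hq hpq
    have h1 : a = a' ∨ a = b' := by
      have : a ∈ ({a', b'} : Finset (Fin k)) := hpq ▸ by simp
      simpa using this
    have h2 : b = a' ∨ b = b' := by
      have : b ∈ ({a', b'} : Finset (Fin k)) := hpq ▸ by simp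
      simpa using this
    ext <;> simp only <;> omega
  · intro s hs
    simp only [Finset.mem_filter, Finset.mem_univ, true_and] at hs
    obtain ⟨a, b, hab, rfl⟩ := Finset.card_eq_two.1 hs
    rcases lt_or_gt_of_ne hab with h | h
    · exact ⟨(a, b), by simpa using h, rfl⟩
    · exact ⟨(b, a), by simpa using h, by simp [Finset.pair_comm]⟩

lemma card_residues : Fintype.card {a : ZMod g // a ≠ 0} = g - 1 := by
  rw [Fintype.card_subtype_compl, ZMod.card]; simp

lemma card_Idx : Fintype.card (Idx g k) = dim g k := by
  rw [Fintype.card_prod, card_pairs, card_residues, dim]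

lemma abs_dotProduct_Z_le {δ : ℝ} {θ : Idx g k → ℝ} (hθ : θ ∈ cube g k δ)
    (x : Fin k → ZMod g) : |θ ⬝ᵥ Z g k x| ≤ dim g k * δ := by
  refine (Finset.abs_sum_le_sum_abs _ _).trans ?_
  refine (Finset.sum_le_card_nsmul _ _ δ fun c _ => ?_).trans_eq ?_
  · rw [abs_mul]
    have h1 := abs_le.2 (hθ c)
    nlinarith [abs_Z_le x c, abs_nonneg (θ c), abs_nonneg (Z g k x c)]
  · rw [Finset.card_univ, card_Idx, nsmul_eq_mul]

end Covariance

/-! ### Square root and determinant of the covariance matrix -/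

section SquareRoot

variable {g k : ℕ} [NeZero g]

lemma kronecker_mul_of {m : Type*} {n : Type*} [Fintype m] [Fintype n] [DecidableEq m]
    [DecidableEq n] (A B : Matrix n n ℝ) :
    Matrix.kronecker (1 : Matrix m m ℝ) A * Matrix.kronecker (1 : Matrix m m ℝ) B =
      Matrix.kronecker (1 : Matrix m m ℝ) (A * B) := by
  rw [Matrix.kronecker, ← Matrix.mul_kronecker_mul, one_mul]

/-- The matrix `a I + b J`, where `J` is the all-ones matrix. -/
def scalarAddConst (g : ℕ) (a b : ℝ) : Matrix {a : ZMod g // a ≠ 0} {a : ZMod g // a ≠ 0} ℝ :=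
  fun r s => (if r = s then a else 0) + b

/-- There are `g - 1` nonzero residues, so J² = (g - 1) J. -/
lemma scalarAddConst_mul (a b a' b' : ℝ) :
    scalarAddConst g a b * scalarAddConst g a' b' =
      scalarAddConst g (a * a') (a * b' + b * a' + ((g : ℝ) - 1) * (b * b')) := by
  have hc : ((g - 1 : ℕ) : ℝ) = (g : ℝ) - 1 := by
    rw [Nat.cast_sub NeZero.one_le, Nat.cast_one]
  ext r s
  simp only [Matrix.mul_apply, scalarAddConst]
  have h : ∀ j, ((if r = j then a else 0) + b) * ((if j = s then a' else 0) + b') =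
      (if r = j then a * ((if j = s then a' else 0) + b') else 0) +
        (if j = s then b * a' else 0) + b * b' := by
    intro j; split_ifs <;> ring
  rw [Finset.sum_congr rfl fun j _ => h j]
  simp only [Finset.sum_add_distrib, Finset.sum_ite_eq, Finset.sum_ite_eq', Finset.mem_univ,
    if_true, Finset.sum_const, Finset.card_univ, card_residues, nsmul_eq_mul, hc]
  split_ifs <;> ring

lemma covMatrix_eq_kronecker : covMatrix g k = Matrix.kronecker
    (1 : Matrix {p : Fin k × Fin k // p.1 < p.2} {p : Fin k × Fin k // p.1 < p.2} ℝ)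
    (scalarAddConst g (1 / g) (-(1 / (g : ℝ) ^ 2))) := by
  have hg : (g : ℝ) ≠ 0 := Nat.cast_ne_zero.2 (NeZero.ne g)
  ext ⟨p, a⟩ ⟨q, b⟩
  simp only [covMatrix, Matrix.kronecker, Matrix.kroneckerMap_apply, Matrix.one_apply,
    scalarAddConst]
  split_ifs
  · field_simp; ring
  · ring
  · ring
  · ring

lemma det_scalarAddConst (a b : ℝ) (ha : a ≠ 0) :
    (scalarAddConst g a b).det = a ^ (g - 1) * (1 + ((g : ℝ) - 1) * (b / a)) := by
  have hc : ((g - 1 : ℕ) : ℝ) = (g : ℝ) - 1 := by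
    rw [Nat.cast_sub NeZero.one_le, Nat.cast_one]
  -- A rank-one perturbation of a scalar matrix, to which the matrix determinant lemma applies.
  have h : scalarAddConst g a b = a • (1 + Matrix.replicateCol Unit (fun _ => b / a) *
      Matrix.replicateRow Unit (fun _ => (1 : ℝ))) := by
    ext r s
    simp only [scalarAddConst, Matrix.smul_apply, Matrix.add_apply, Matrix.one_apply,
      Matrix.mul_apply, Matrix.replicateCol_apply, Matrix.replicateRow_apply, smul_eq_mul,
      Finset.univ_unique, Finset.sum_singleton]
    split_ifs <;> field_simp; ring
  rw [h, Matrix.det_smul, card_residues, Matrix.det_one_add_replicateCol_mul_replicateRow]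
  simp only [dotProduct, one_mul, Finset.sum_const, Finset.card_univ, card_residues, nsmul_eq_mul,
    hc]

lemma det_covMatrix : (covMatrix g k).det = ((g : ℝ) ^ (g * k.choose 2))⁻¹ := by
  have hg : (g : ℝ) ≠ 0 := Nat.cast_ne_zero.2 (NeZero.ne g)
  rw [covMatrix_eq_kronecker, Matrix.kronecker, Matrix.det_kronecker, Matrix.det_one, one_pow,
    one_mul, card_pairs, det_scalarAddConst _ _ (by positivity), pow_mul, ← inv_pow]
  congr 1
  have h1 : 1 + ((g : ℝ) - 1) * (-(1 / (g : ℝ) ^ 2) / (1 / g)) = (g : ℝ)⁻¹ := by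
    field_simp; ring
  rw [h1, one_div, ← pow_succ, Nat.sub_add_cancel NeZero.one_le, inv_pow]

/-- The hypothesis on `D` bounds the absolute row sums, that is, the sup-norm operator norm, which
does not depend on `k`. -/
lemma mulVec_kronecker_mem_cube {a b D r : ℝ} (hD : |a| + ((g : ℝ) - 1) * |b| ≤ D)
    {θ : Idx g k → ℝ} (hθ : θ ∈ cube g k r) :
    (Matrix.kronecker
      (1 : Matrix {p : Fin k × Fin k // p.1 < p.2} {p : Fin k × Fin k // p.1 < p.2} ℝ)
      (scalarAddConst g a b)).mulVec θ ∈ cube g k (D * r) := by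
  have hc : ((g - 1 : ℕ) : ℝ) = (g : ℝ) - 1 := by
    rw [Nat.cast_sub NeZero.one_le, Nat.cast_one]
  rintro ⟨p, s⟩
  have hr : 0 ≤ r := (abs_nonneg _).trans (abs_le.2 (hθ (p, s)))
  have h1 : (Matrix.kronecker
      (1 : Matrix {p : Fin k × Fin k // p.1 < p.2} {p : Fin k × Fin k // p.1 < p.2} ℝ)
      (scalarAddConst g a b)).mulVec θ (p, s) = a * θ (p, s) + ∑ j, b * θ (p, j) := by
    simp only [Matrix.mulVec, dotProduct, Matrix.kronecker, Matrix.kroneckerMap_apply,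
      Matrix.one_apply, scalarAddConst, Fintype.sum_prod_type, ite_mul, one_mul, zero_mul,
      add_mul]
    rw [Finset.sum_comm]
    simp [Finset.sum_add_distrib]
  have h2 : |∑ j, b * θ (p, j)| ≤ ((g : ℝ) - 1) * (|b| * r) := by
    refine (Finset.abs_sum_le_sum_abs _ _).trans ?_
    refine (Finset.sum_le_card_nsmul _ _ (|b| * r) fun j _ => ?_).trans_eq ?_
    · rw [abs_mul]
      exact mul_le_mul_of_nonneg_left (abs_le.2 (hθ _)) (abs_nonneg _)
    · rw [Finset.card_univ, card_residues, nsmul_eq_mul, hc]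
  have h3 : |a * θ (p, s)| ≤ |a| * r := by
    rw [abs_mul]
    exact mul_le_mul_of_nonneg_left (abs_le.2 (hθ _)) (abs_nonneg _)
  rw [h1]
  refine abs_le.1 ((abs_add_le _ _).trans ?_)
  nlinarith

theorem exists_cubeConstants (hg : 2 ≤ g) : ∃ D₁ D₂ : ℝ, ∀ k : ℕ, CubeConstants g k D₁ D₂ := by
  have hg2 : (2 : ℝ) ≤ g := by exact_mod_cast hg
  have hg0 : (0 : ℝ) < g := by linarith
  obtain ⟨s, hs, hs1⟩ : ∃ s : ℝ, s ^ 2 = g ∧ 1 < s :=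
    ⟨Real.sqrt g, Real.sq_sqrt hg0.le, Real.lt_sqrt_of_sq_lt (by linarith)⟩
  have hs0 : 0 < s := by linarith
  -- Each block of M has eigenvalue 1/g² on constant vectors and 1/g on their complement. With s =
  -- √g, the root aI + bJ has eigenvalues 1/g and 1/s there, and its inverse sI + b'J has g and s.
  -- The inverse has row sums g, whence D₁ = 1/g; the absolute row sums of the root are at most 2.
  refine ⟨1 / g, 2, fun k => ⟨by positivity, two_pos, ?_⟩⟩
  set a : ℝ := 1 / s with ha
  set b : ℝ := -(1 / (s ^ 2 * (s + 1))) with hb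
  set b' : ℝ := s / (s + 1) with hb'
  have hQQ : scalarAddConst g a b * scalarAddConst g a b =
      scalarAddConst g (1 / g) (-(1 / (g : ℝ) ^ 2)) := by
    rw [scalarAddConst_mul, ← hs]
    congr 1
    · rw [ha]; field_simp
    · rw [ha, hb]; field_simp; ring
  have hQR : scalarAddConst g a b * scalarAddConst g s b' = 1 := by
    rw [scalarAddConst_mul, ← hs]
    have h1 : a * s = 1 := by rw [ha]; field_simp
    have h2 : a * b' + b * s + (s ^ 2 - 1) * (b * b') = 0 := by
      rw [ha, hb, hb']; field_simp; ring
    rw [h1, h2]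
    ext i j
    simp [scalarAddConst, Matrix.one_apply]
  refine ⟨Matrix.kronecker 1 (scalarAddConst g a b), ?_, ?_, fun δ hδ => ⟨?_, ?_⟩⟩
  · ext ⟨p, r⟩ ⟨q, s⟩
    simp only [Matrix.transpose_apply, Matrix.kronecker, Matrix.kroneckerMap_apply,
      Matrix.one_apply, scalarAddConst, eq_comm]
  · rw [kronecker_mul_of, hQQ, covMatrix_eq_kronecker]
  · intro θ hθ
    refine ⟨(Matrix.kronecker 1 (scalarAddConst g s b')).mulVec θ, ?_, ?_⟩
    · have h := mulVec_kronecker_mem_cube (D := g) (a := s) (b := b') ?_ hθ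
      · rwa [← mul_assoc, mul_one_div_cancel hg0.ne', one_mul] at h
      · rw [abs_of_pos hs0, abs_of_pos (by positivity), ← hs, hb']
        apply le_of_eq; field_simp; ring
    · rw [Matrix.mulVec_mulVec, kronecker_mul_of, hQR]
      simp [Matrix.kronecker]
  · rintro _ ⟨θ, hθ, rfl⟩
    refine mulVec_kronecker_mem_cube ?_ hθ
    have h1 : |a| ≤ 1 := by
      rw [ha, abs_of_pos (by positivity), div_le_one hs0]; linarith
    have h2 : ((g : ℝ) - 1) * |b| ≤ 1 := by
      rw [hb, abs_neg, abs_of_pos (by positivity), ← hs, mul_one_div,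
        div_le_one (by positivity)]
      nlinarith
    linarith

end SquareRoot

/-! ### Fourier inversion for the return probability -/

section Fourier

/-- The characteristic function of one step of the walk. -/
noncomputable def stepChar (g k : ℕ) [NeZero g] (θ : Idx g k → ℝ) : ℂ :=
  ((g : ℂ) ^ k)⁻¹ * ∑ x, Complex.exp (Complex.I * (θ ⬝ᵥ Z g k x : ℝ))

/-- A fundamental domain for `(2πℤ)^d`. -/
def box (g k : ℕ) : Set (Idx g k → ℝ) :=
  Set.univ.pi fun _ => Set.Ioc (-(Real.pi / g)) (-(Real.pi / g) + 2 * Real.pi)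

variable {g k : ℕ} [NeZero g]

omit [NeZero g] in
lemma Z_eq_iff (hk : 0 < k) (x y : Fin k → ZMod g) :
    Z g k x = Z g k y ↔ ∃ s : ZMod g, y = x + fun _ => s := by
  have hZ : ∀ (c : Idx g k), Z g k x c = Z g k y c →
      (x c.1.1.1 - x c.1.1.2 = c.2.1 ↔ y c.1.1.1 - y c.1.1.2 = c.2.1) := by
    intro c h
    unfold Z at h
    split_ifs at h with h1 h2 h2
    · simp [h1, h2]
    · linarith
    · linarith
    · simp [h1, h2]
  constructor
  · intro h
    have key : ∀ i j : Fin k, i < j → x i - x j = y i - y j := by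
      intro i j hij
      -- The residue 0 indexes no coordinate. A vanishing difference is detected through the
      -- coordinate of the other column's difference.
      by_cases h0 : x i - x j = 0
      · by_contra h1
        rw [h0] at h1
        have h2 := (hZ (⟨(i, j), hij⟩, ⟨y i - y j, fun h => h1 h.symm⟩) (congrFun h _)).2 rfl
        exact h1 (h0 ▸ h2)
      · exact ((hZ (⟨(i, j), hij⟩, ⟨x i - x j, h0⟩) (congrFun h _)).1 rfl).symm
    refine ⟨y ⟨0, hk⟩ - x ⟨0, hk⟩, ?_⟩
    ext i
    rw [Pi.add_apply]
    by_cases hi : i = ⟨0, hk⟩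
    · subst hi; ring
    · have h1 : (⟨0, hk⟩ : Fin k) < i := by
        rw [Fin.lt_def]
        exact Nat.pos_of_ne_zero fun h => hi (Fin.ext h)
      linear_combination key _ _ h1
  · rintro ⟨s, rfl⟩
    funext c
    simp [Z]

/-- The fibres of `Z` are the cosets of the constant columns, each of size `g`. Hence the uniform
law on the range of `Z` is the image of the uniform law on columns. -/
lemma sum_Z_comp (hk : 0 < k) (f : (Idx g k → ℝ) → ℂ) :
    ∑ x, f (Z g k x) = (g : ℂ) * ∑ z ∈ Finset.univ.image (Z g k), f z := by
  rw [Finset.sum_comp f (Z g k), Finset.mul_sum]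
  refine Finset.sum_congr rfl fun z hz => ?_
  obtain ⟨x, -, rfl⟩ := Finset.mem_image.1 hz
  have h : (Finset.univ.filter fun y => Z g k y = Z g k x) =
      Finset.univ.image fun s : ZMod g => x + fun _ => s := by
    ext y
    simp only [Finset.mem_filter, Finset.mem_univ, true_and, Finset.mem_image]
    rw [eq_comm, Z_eq_iff hk]
    simp only [eq_comm]
  rw [h, Finset.card_image_of_injective, Finset.card_univ, ZMod.card, nsmul_eq_mul]
  intro s s' h
  simpa using congrFun h ⟨0, hk⟩

lemma integral_uniformOn_finset {E : Type*} [MeasurableSpace E] [MeasurableSingletonClass E]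
    (s : Finset E) (f : E → ℂ) :
    ∫ z, f z ∂(uniformOn (s : Set E)) = (s.card : ℂ)⁻¹ * ∑ z ∈ s, f z := by
  rw [uniformOn, ProbabilityTheory.cond, integral_smul_measure, setIntegral_finset, Measure.count_apply_finset]
  · simp [measureReal_def]
  · rw [← Set.biUnion_of_singleton (s : Set E)]
    refine (integrableOn_finite_biUnion s.finite_toSet).2 fun z _ => ?_
    exact integrableOn_singleton (by simp) (by simp)

lemma integral_uniformOn_range_Z (hk : 0 < k) (θ : Idx g k → ℝ) :
    ∫ z, Complex.exp (Complex.I * (θ ⬝ᵥ z : ℝ)) ∂(uniformOn (Set.range (Z g k))) =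
      stepChar g k θ := by
  have hg : (g : ℂ) ≠ 0 := Nat.cast_ne_zero.2 (NeZero.ne g)
  have h1 : Set.range (Z g k) = ((Finset.univ.image (Z g k) : Finset _) : Set _) := by simp
  have h2 := sum_Z_comp (g := g) hk (fun _ => 1)
  simp only [Finset.sum_const, Finset.card_univ, nsmul_eq_mul, mul_one, Fintype.card_fun,
    Fintype.card_fin, ZMod.card] at h2
  push_cast at h2
  rw [h1, integral_uniformOn_finset, stepChar,
    sum_Z_comp hk fun z => Complex.exp (Complex.I * (θ ⬝ᵥ z : ℝ)), h2]
  field_simp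

lemma integral_exp_int (a : ℝ) (m : ℤ) :
    ∫ x in Set.Ioc a (a + 2 * Real.pi), Complex.exp (Complex.I * ((x * m : ℝ) : ℂ)) =
      if m = 0 then (2 * Real.pi : ℂ) else 0 := by
  rw [← intervalIntegral.integral_of_le (by linarith [Real.pi_pos])]
  split_ifs with h
  · subst h; simp
  · have hc : Complex.I * m ≠ 0 := mul_ne_zero Complex.I_ne_zero (Int.cast_ne_zero.2 h)
    have h1 : ∀ x : ℝ, Complex.exp (Complex.I * ((x * m : ℝ) : ℂ)) =
        Complex.exp ((Complex.I * m) * x) := by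
      intro x; push_cast; ring_nf
    simp only [h1]
    rw [integral_exp_mul_complex hc]
    have h2 : Complex.exp (Complex.I * m * ((a + 2 * Real.pi : ℝ) : ℂ)) =
        Complex.exp (Complex.I * m * a) := by
      rw [Complex.exp_eq_exp_iff_exists_int]
      exact ⟨m, by push_cast; ring⟩
    rw [h2, sub_self, zero_div]

lemma integral_box_exp (n : Idx g k → ℤ) :
    ∫ θ in box g k, Complex.exp (Complex.I * (θ ⬝ᵥ (fun c => (n c : ℝ)) : ℝ)) =
      if n = 0 then (2 * Real.pi : ℂ) ^ dim g k else 0 := by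
  have h1 : ∀ θ : Idx g k → ℝ, Complex.exp (Complex.I * (θ ⬝ᵥ (fun c => (n c : ℝ)) : ℝ)) =
      ∏ c, Complex.exp (Complex.I * ((θ c * n c : ℝ) : ℂ)) := by
    intro θ
    rw [← Complex.exp_sum, ← Finset.mul_sum]
    simp [dotProduct]
  simp only [h1]
  rw [box, volume_pi, Measure.restrict_pi_pi,
    integral_fintype_prod_eq_prod (fun c (x : ℝ) => Complex.exp (Complex.I * ((x * n c : ℝ) : ℂ)))]
  simp only [integral_exp_int]
  split_ifs with h
  · subst h; simp [card_Idx, -Fintype.card_prod]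
  · obtain ⟨c, hc⟩ := Function.ne_iff.1 h
    exact Finset.prod_eq_zero (Finset.mem_univ c) (if_neg hc)

lemma volume_box : volume (box g k) = ENNReal.ofReal ((2 * Real.pi) ^ dim g k) := by
  rw [box, Real.volume_pi_Ioc]
  simp only [add_sub_cancel_left, Finset.prod_const, Finset.card_univ, card_Idx]
  rw [ENNReal.ofReal_pow (by positivity)]

variable {Ω : Type*} [MeasurableSpace Ω] {μ : Measure Ω} [IsProbabilityMeasure μ]
  {ξ : ℕ → Ω → Idx g k → ℝ}

omit [NeZero g] [IsProbabilityMeasure μ] in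
lemma aemeasurable_walk (hξ : IsStepSequence g k μ ξ) (t : ℕ) : AEMeasurable (walk ξ t) μ :=
  Finset.aemeasurable_fun_sum _ fun n _ => (hξ.law n).aemeasurable

omit [IsProbabilityMeasure μ] in
lemma integral_exp_walk (hk : 0 < k) (hξ : IsStepSequence g k μ ξ) (t : ℕ) (θ : Idx g k → ℝ) :
    ∫ ω, Complex.exp (Complex.I * (θ ⬝ᵥ walk ξ t ω : ℝ)) ∂μ = stepChar g k θ ^ t := by
  have hcont : Continuous fun z : Idx g k → ℝ => Complex.exp (Complex.I * (θ ⬝ᵥ z : ℝ)) := by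
    unfold dotProduct; fun_prop
  have h1 : ∀ ω, Complex.exp (Complex.I * (θ ⬝ᵥ walk ξ t ω : ℝ)) =
      ∏ n : Fin t, Complex.exp (Complex.I * (θ ⬝ᵥ ξ n ω : ℝ)) := by
    intro ω
    rw [← Complex.exp_sum, ← Finset.mul_sum, walk, dotProduct_sum,
      Fin.sum_univ_eq_sum_range (fun n => ((θ ⬝ᵥ ξ n ω : ℝ) : ℂ)) t, Complex.ofReal_sum]
  simp only [h1]
  have hind : iIndepFun (fun n : Fin t => ξ n) μ := hξ.indep.precomp Fin.val_injective
  rw [hind.integral_fun_prod_comp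
    (f := fun _ z => Complex.exp (Complex.I * (θ ⬝ᵥ z : ℝ)))
    (fun n => (hξ.law n).aemeasurable) (fun n => hcont.aestronglyMeasurable)]
  rw [Finset.prod_congr rfl (g := fun _ => stepChar g k θ), Finset.prod_const, Finset.card_univ,
    Fintype.card_fin]
  intro n _
  rw [← integral_uniformOn_range_Z hk]
  exact (hξ.law n).integral_comp hcont.aestronglyMeasurable

omit [IsProbabilityMeasure μ] in
lemma ae_walk_int (hξ : IsStepSequence g k μ ξ) {t : ℕ} (hgt : g ∣ t) :
    ∀ᵐ ω ∂μ, ∃ n : Idx g k → ℤ, walk ξ t ω = fun c => (n c : ℝ) := by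
  have hg : (g : ℝ) ≠ 0 := Nat.cast_ne_zero.2 (NeZero.ne g)
  have h1 : ∀ᵐ ω ∂μ, ∀ n, ξ n ω ∈ Set.range (Z g k) := by
    rw [ae_all_iff]
    intro n
    have hfin : (Set.range (Z g k)).Finite := Set.finite_range _
    rw [(hξ.law n).ae_iff (p := fun z => z ∈ Set.range (Z g k)) hfin.measurableSet.mem]
    rw [ae_iff]
    have h2 : {z | z ∉ Set.range (Z g k)} = (Set.range (Z g k))ᶜ := rfl
    rw [h2, uniformOn_eq_zero_iff hfin, Set.inter_compl_self]
  filter_upwards [h1] with ω hω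
  choose x hx using hω
  obtain ⟨m, rfl⟩ := hgt
  refine ⟨fun c => ∑ n ∈ Finset.range (g * m),
    (if x n c.1.1.1 - x n c.1.1.2 = c.2.1 then 1 else 0) - m, ?_⟩
  funext c
  rw [walk, Finset.sum_apply]
  have h3 : ∀ n, ξ n ω c =
      (if x n c.1.1.1 - x n c.1.1.2 = c.2.1 then (1 : ℝ) else 0) - 1 / g := by
    intro n
    rw [← hx]
    unfold Z
    split_ifs <;> ring
  simp only [h3, Finset.sum_sub_distrib]
  push_cast
  congr 1
  simp
  field_simp

/-- Fourier inversion for the return probability. -/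
theorem prob_walk_eq_zero (hk : 0 < k) (hξ : IsStepSequence g k μ ξ) {t : ℕ} (hgt : g ∣ t) :
    ((2 * Real.pi : ℂ) ^ dim g k) * (μ.real {ω | walk ξ t ω = 0} : ℂ) =
      ∫ θ in box g k, stepChar g k θ ^ t := by
  have hw := aemeasurable_walk hξ t
  set ρ := μ.map (walk ξ t) with hρ
  have : IsProbabilityMeasure ρ := Measure.isProbabilityMeasure_map hw
  have hcont : Continuous fun p : (Idx g k → ℝ) × (Idx g k → ℝ) =>
      Complex.exp (Complex.I * (p.1 ⬝ᵥ p.2 : ℝ)) := by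
    unfold dotProduct; fun_prop
  have hc : ∀ θ : Idx g k → ℝ, stepChar g k θ ^ t =
      ∫ y, Complex.exp (Complex.I * (θ ⬝ᵥ y : ℝ)) ∂ρ := by
    intro θ
    rw [← integral_exp_walk hk hξ, hρ, integral_map hw]
    exact (hcont.comp (Continuous.prodMk_right θ)).aestronglyMeasurable
  simp only [hc]
  have : IsFiniteMeasure (volume.restrict (box g k)) :=
    ⟨by rw [Measure.restrict_apply_univ, volume_box]; exact ENNReal.ofReal_lt_top⟩
  rw [integral_integral_swap]
  · have hae : ∀ᵐ y ∂ρ, ∫ θ in box g k, Complex.exp (Complex.I * (θ ⬝ᵥ y : ℝ)) =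
        Set.indicator {0} (fun _ => (2 * Real.pi : ℂ) ^ dim g k) y := by
      have h4 : ∀ᵐ y ∂ρ, y ∈ Set.range fun (n : Idx g k → ℤ) c => (n c : ℝ) := by
        rw [hρ, ae_map_iff hw]
        · filter_upwards [ae_walk_int hξ hgt] with ω hω
          obtain ⟨n, hn⟩ := hω
          exact ⟨n, hn.symm⟩
        · exact (Set.countable_range _).measurableSet
      filter_upwards [h4] with y hy
      obtain ⟨n, rfl⟩ := hy
      rw [integral_box_exp, Set.indicator_apply]
      refine if_congr ?_ rfl rfl
      simp [funext_iff]
    rw [integral_congr_ae hae, integral_indicator (measurableSet_singleton 0), setIntegral_const,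
      mul_comm, Complex.real_smul]
    congr 2
    rw [hρ, map_measureReal_apply_of_aemeasurable hw (measurableSet_singleton 0)]
    rfl
  · refine Integrable.of_bound (C := 1) hcont.aestronglyMeasurable (Filter.Eventually.of_forall ?_)
    rintro ⟨θ, y⟩
    simp only [Function.uncurry, mul_comm Complex.I, Complex.norm_exp_ofReal_mul_I, le_refl]

end Fourier

/-! ### Peaks of the characteristic function and their number -/

section Peaks

/-- The pairs of rows. -/
abbrev Pairs (k : ℕ) : Type := {p : Fin k × Fin k // p.1 < p.2}

/-- The families of residues that parametrize the points where `stepChar` has modulus one. -/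
def peakIndex (g k : ℕ) [NeZero g] : Finset (Pairs k → ZMod g) :=
  Finset.univ.filter fun c => ∀ x : Fin k → ZMod g, ∑ p, c p * (x p.1.1 - x p.1.2) = 0

/-- The points where `stepChar` has modulus one. -/
noncomputable def peak {g k : ℕ} (c : Pairs k → ZMod g) : Idx g k → ℝ := fun q =>
  2 * Real.pi * ((c q.1 * q.2.1).val : ℝ) / g

/-- A vector, seen as a family of functions on `ZMod g` that vanish at the origin. -/
noncomputable def ext {g k : ℕ} (θ : Idx g k → ℝ) (p : Pairs k) (a : ZMod g) : ℝ :=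
  if h : a ≠ 0 then θ (p, ⟨a, h⟩) else 0

/-- The phase at a column, up to an additive constant. -/
noncomputable def phase {g k : ℕ} (θ : Idx g k → ℝ) (x : Fin k → ZMod g) : ℝ :=
  ∑ p : Pairs k, ext θ p (x p.1.1 - x p.1.2)

variable {g k : ℕ}

lemma ext_zero (θ : Idx g k → ℝ) (p : Pairs k) : ext θ p 0 = 0 := by simp [ext]

lemma phase_zero (θ : Idx g k → ℝ) : phase θ 0 = 0 := by simp [phase, ext_zero]

lemma ext_peak (c : Pairs k → ZMod g) (p : Pairs k) (a : ZMod g) :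
    ext (peak c) p a = 2 * Real.pi * ((c p * a).val : ℝ) / g := by
  unfold ext
  split_ifs with h
  · rfl
  · rw [not_not.1 h]; simp

variable [NeZero g]

/-- The subtracted term does not depend on `x`, so only `phase` matters for the modulus of
`stepChar`. -/
lemma dotProduct_Z (θ : Idx g k → ℝ) (x : Fin k → ZMod g) :
    θ ⬝ᵥ Z g k x = phase θ x - (∑ q, θ q) / g := by
  have h : ∀ q : Idx g k, θ q * Z g k x q =
      (if x q.1.1.1 - x q.1.1.2 = q.2.1 then θ q else 0) - θ q / g := by
    intro q; unfold Z; split_ifs <;> ring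
  rw [dotProduct, Finset.sum_congr rfl fun q _ => h q, Finset.sum_sub_distrib, ← Finset.sum_div,
    Fintype.sum_prod_type, phase]
  congr 1
  refine Finset.sum_congr rfl fun p _ => ?_
  simp only [ext]
  split_ifs with h
  · rw [Finset.sum_eq_single ⟨_, h⟩]
    · simp
    · intro a _ ha
      rw [if_neg]
      intro h1
      exact ha (Subtype.ext h1.symm)
    · simp
  · refine Finset.sum_eq_zero fun a _ => if_neg fun h1 => h fun h2 => a.2 (h1.symm.trans h2)

lemma sum_val_eq {ι : Type*} (s : Finset ι) (f : ι → ZMod g) (h : ∑ i ∈ s, f i = 0) :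
    ∃ m : ℕ, ∑ i ∈ s, (f i).val = g * m := by
  have h1 : ((∑ i ∈ s, (f i).val : ℕ) : ZMod g) = 0 := by
    push_cast
    simpa using h
  exact (ZMod.natCast_eq_zero_iff _ _).1 h1

lemma phase_peak {c : Pairs k → ZMod g} (hc : c ∈ peakIndex g k) (x : Fin k → ZMod g) :
    ∃ m : ℕ, phase (peak c) x = 2 * Real.pi * m := by
  have hg : (g : ℝ) ≠ 0 := Nat.cast_ne_zero.2 (NeZero.ne g)
  obtain ⟨m, hm⟩ := sum_val_eq _ _ ((Finset.mem_filter.1 hc).2 x)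
  refine ⟨m, ?_⟩
  simp only [phase, ext_peak]
  rw [← Finset.sum_div, ← Finset.mul_sum, ← Nat.cast_sum, hm]
  push_cast
  field_simp

lemma stepChar_peak_add {c : Pairs k → ZMod g} (hc : c ∈ peakIndex g k) (θ : Idx g k → ℝ) :
    stepChar g k (peak c + θ) =
      Complex.exp (Complex.I * (-((∑ q : Idx g k, peak c q) / g) : ℝ)) * stepChar g k θ := by
  unfold stepChar
  rw [mul_left_comm]
  congr 1
  rw [Finset.mul_sum]
  refine Finset.sum_congr rfl fun x _ => ?_
  obtain ⟨m, hm⟩ := phase_peak hc x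
  rw [add_dotProduct, dotProduct_Z (peak c), hm, ← Complex.exp_add, Complex.exp_eq_exp_iff_exists_int]
  refine ⟨m, ?_⟩
  push_cast
  ring

/-- Twice the sum of the coordinates of a peak lies in `2πℤ`. -/
lemma two_mul_sum_peak (c : Pairs k → ZMod g) :
    ∃ m : ℤ, 2 * ∑ q : Idx g k, peak c q = 2 * Real.pi * m := by
  have hg : (g : ℝ) ≠ 0 := Nat.cast_ne_zero.2 (NeZero.ne g)
  -- The involution a ↦ -a pairs the coordinates: the representatives of `c p * a` and `c p * -a`
  -- add up to a multiple of `g`.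
  have h1 : ∀ p : Pairs k, ∑ a : {a : ZMod g // a ≠ 0}, peak c (p, a) =
      ∑ a : {a : ZMod g // a ≠ 0}, peak c (p, ⟨-a.1, neg_ne_zero.2 a.2⟩) := by
    intro p
    let e : {a : ZMod g // a ≠ 0} ≃ {a : ZMod g // a ≠ 0} :=
      { toFun := fun a => ⟨-a.1, neg_ne_zero.2 a.2⟩
        invFun := fun a => ⟨-a.1, neg_ne_zero.2 a.2⟩
        left_inv := fun a => by simp
        right_inv := fun a => by simp }
    exact (Equiv.sum_comp e fun a => peak c (p, a)).symm
  have h2 : ∀ (p : Pairs k) (a : {a : ZMod g // a ≠ 0}), ∃ m : ℤ,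
      peak c (p, a) + peak c (p, ⟨-a.1, neg_ne_zero.2 a.2⟩) = 2 * Real.pi * m := by
    intro p a
    obtain ⟨m, hm⟩ := sum_val_eq (Finset.univ : Finset Bool)
      (fun b => if b then c p * a.1 else c p * -a.1) (by simp)
    simp only [Fintype.sum_bool, if_true, Bool.false_eq_true, if_false] at hm
    refine ⟨m, ?_⟩
    unfold peak
    rw [← add_div, ← mul_add, ← Nat.cast_add, hm]
    push_cast
    field_simp
  choose m hm using h2
  refine ⟨∑ p, ∑ a, m p a, ?_⟩
  rw [two_mul, Fintype.sum_prod_type]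
  nth_rewrite 2 [Finset.sum_congr rfl fun p _ => h1 p]
  rw [← Finset.sum_add_distrib]
  push_cast
  rw [Finset.mul_sum]
  refine Finset.sum_congr rfl fun p _ => ?_
  rw [← Finset.sum_add_distrib, Finset.mul_sum]
  exact Finset.sum_congr rfl fun a _ => hm p a

lemma mul_sum_peak (c : Pairs k → ZMod g) :
    ∃ m : ℤ, g * ∑ q : Idx g k, peak c q = 2 * Real.pi * m := by
  have hg : (g : ℝ) ≠ 0 := Nat.cast_ne_zero.2 (NeZero.ne g)
  refine ⟨∑ q : Idx g k, ((c q.1 * q.2.1).val : ℤ), ?_⟩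
  push_cast
  rw [Finset.mul_sum, Finset.mul_sum]
  refine Finset.sum_congr rfl fun q _ => ?_
  unfold peak
  field_simp

lemma stepChar_peak_add_pow {c : Pairs k → ZMod g} (hc : c ∈ peakIndex g k) (θ : Idx g k → ℝ)
    {t : ℕ} (hgt : g ∣ t) (hpar : Odd g ∨ (Even g ∧ Even (t / g))) :
    stepChar g k (peak c + θ) ^ t = stepChar g k θ ^ t := by
  have hg : (g : ℝ) ≠ 0 := Nat.cast_ne_zero.2 (NeZero.ne g)
  obtain ⟨m, hm⟩ := two_mul_sum_peak c
  obtain ⟨n, hn⟩ := mul_sum_peak c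
  obtain ⟨s, rfl⟩ := hgt
  rw [Nat.mul_div_cancel_left _ (NeZero.pos g)] at hpar
  -- With S the sum of the peak and t = gs, the t-th power of the constant is exp(-isS). Both 2S and
  -- gS lie in 2πℤ. If g = 2r + 1, then S = gS - r(2S) does too; if s = 2r, then sS = r(2S).
  have h1 : ∃ l : ℤ, s * ∑ q : Idx g k, peak c q = 2 * Real.pi * l := by
    rcases hpar with ⟨r, hr⟩ | ⟨-, ⟨r, hr⟩⟩
    · refine ⟨s * (n - r * m), ?_⟩
      have hr' : (g : ℝ) = 2 * r + 1 := by exact_mod_cast hr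
      push_cast
      rw [hr'] at hn
      linear_combination (s : ℝ) * hn - s * r * hm
    · refine ⟨r * m, ?_⟩
      have hr' : (s : ℝ) = r + r := by exact_mod_cast hr
      push_cast
      rw [hr']
      linear_combination (r : ℝ) * hm
  obtain ⟨l, hl⟩ := h1
  rw [stepChar_peak_add hc, mul_pow, ← Complex.exp_nat_mul]
  have h2 : ((g * s : ℕ) : ℂ) * (Complex.I * (-((∑ q : Idx g k, peak c q) / g) : ℝ)) =
      ((-l : ℤ) : ℂ) * (2 * Real.pi * Complex.I) := by
    have h3 : ((g * s : ℕ) : ℝ) * (-((∑ q : Idx g k, peak c q) / g)) = -(2 * Real.pi * l) := by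
      push_cast
      rw [← hl]
      field_simp
    calc _ = Complex.I * (((g * s : ℕ) : ℝ) * (-((∑ q : Idx g k, peak c q) / g)) : ℝ) := by
          push_cast; ring
      _ = _ := by rw [h3]; push_cast; ring
  rw [h2, Complex.exp_int_mul_two_pi_mul_I, one_mul]

omit [NeZero g] in
lemma peak_nonneg (c : Pairs k → ZMod g) (q : Idx g k) : 0 ≤ peak c q := by
  unfold peak; positivity

lemma peak_le (c : Pairs k → ZMod g) (q : Idx g k) :
    peak c q ≤ 2 * Real.pi - 2 * (Real.pi / g) := by
  have hg : (0 : ℝ) < g := Nat.cast_pos.2 (NeZero.pos g)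
  have h : ((c q.1 * q.2.1).val : ℝ) + 1 ≤ g := by exact_mod_cast ZMod.val_lt (c q.1 * q.2.1)
  have h2 : 2 * Real.pi - 2 * (Real.pi / g) = 2 * Real.pi * ((g : ℝ) - 1) / g := by
    field_simp
  unfold peak
  rw [h2]
  gcongr
  linarith

/-- The coordinates with residue 1 already determine the family. The separation makes the cubes
around peaks disjoint once δ < π/g. -/
lemma exists_peak_sub (hg : 2 ≤ g) {c c' : Pairs k → ZMod g} (h : c ≠ c') :
    ∃ q, 2 * (Real.pi / g) ≤ |peak c q - peak c' q| := by
  have hg0 : (0 : ℝ) < g := Nat.cast_pos.2 (NeZero.pos g)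
  have : Fact (1 < g) := ⟨hg⟩
  obtain ⟨p, hp⟩ := Function.ne_iff.1 h
  refine ⟨(p, ⟨1, one_ne_zero⟩), ?_⟩
  have h1 : (c p).val ≠ (c' p).val := fun h2 => hp (ZMod.val_injective g h2)
  have h2 : (1 : ℝ) ≤ |((c p).val : ℝ) - (c' p).val| := by
    have h3 : ((c p).val : ℤ) - (c' p).val ≠ 0 := sub_ne_zero.2 (by exact_mod_cast h1)
    exact_mod_cast Int.one_le_abs h3
  have h4 : peak c (p, ⟨1, one_ne_zero⟩) - peak c' (p, ⟨1, one_ne_zero⟩) =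
      2 * (Real.pi / g) * (((c p).val : ℝ) - (c' p).val) := by
    simp only [peak, mul_one]; ring
  rw [h4, abs_mul, abs_of_pos (by positivity)]
  exact le_mul_of_one_le_right (by positivity) h2

/-- Evaluation of a family of residues on the coordinate vectors other than the first one. -/
def boundary (g k : ℕ) : (Pairs (k + 1) → ZMod g) →+ (Fin k → ZMod g) where
  toFun c j := ∑ p : Pairs (k + 1), c p * ((Pi.single j.succ (1 : ZMod g) : Fin (k + 1) → ZMod g)
    p.1.1 - (Pi.single j.succ (1 : ZMod g) : Fin (k + 1) → ZMod g) p.1.2)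
  map_zero' := by ext; simp
  map_add' c c' := by ext j; simp [add_mul, Finset.sum_add_distrib]

lemma mem_ker_boundary (c : Pairs (k + 1) → ZMod g) :
    c ∈ (boundary g k).ker ↔ c ∈ peakIndex g (k + 1) := by
  rw [AddMonoidHom.mem_ker, peakIndex, Finset.mem_filter]
  constructor
  · intro h
    refine ⟨Finset.mem_univ _, fun x => ?_⟩
    -- Constant columns have zero differences, so testing the basis columns other than the first
    -- suffices.
    have hx : ∀ i, x i = x 0 + ∑ j : Fin k, (x j.succ - x 0) *
        (Pi.single j.succ (1 : ZMod g) : Fin (k + 1) → ZMod g) i := by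
      intro i
      refine Fin.cases ?_ (fun i => ?_) i
      · simp [(Fin.succ_ne_zero _).symm]
      · simp [Pi.single_apply]
    have h1 : ∀ p : Pairs (k + 1), c p * (x p.1.1 - x p.1.2) = ∑ j : Fin k, (x j.succ - x 0) *
        (c p * ((Pi.single j.succ (1 : ZMod g) : Fin (k + 1) → ZMod g) p.1.1 -
          (Pi.single j.succ (1 : ZMod g) : Fin (k + 1) → ZMod g) p.1.2)) := by
      intro p
      rw [hx p.1.1, hx p.1.2, add_sub_add_left_eq_sub, ← Finset.sum_sub_distrib, Finset.mul_sum]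
      exact Finset.sum_congr rfl fun j _ => by ring
    rw [Finset.sum_congr rfl fun p _ => h1 p, Finset.sum_comm]
    refine Finset.sum_eq_zero fun j _ => ?_
    rw [← Finset.mul_sum]
    have := congrFun h j
    simp only [boundary, AddMonoidHom.coe_mk, ZeroHom.coe_mk, Pi.zero_apply] at this
    rw [this, mul_zero]
  · intro h
    funext j
    exact h.2 _

omit [NeZero g] in
lemma boundary_surjective : Function.Surjective (boundary g k) := by
  intro y
  -- A family supported on the pairs (0, j). The sign is there because x_0 - x_j equals -1 on the
  -- j-th basis column.
  refine ⟨fun p => if p.1.1 = 0 then -(Fin.cons 0 y : Fin (k + 1) → ZMod g) p.1.2 else 0, ?_⟩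
  funext j
  simp only [boundary, AddMonoidHom.coe_mk, ZeroHom.coe_mk]
  rw [Finset.sum_eq_single (⟨(0, j.succ), Fin.succ_pos j⟩ : Pairs (k + 1))]
  · simp [(Fin.succ_ne_zero _).symm]
  · rintro ⟨⟨a, b⟩, hab⟩ - hne
    simp only
    split_ifs with h
    · subst h
      have hb : b ≠ j.succ := by rintro rfl; exact hne rfl
      simp [(Fin.succ_ne_zero _).symm, hb]
    · simp
  · simp

theorem card_peakIndex (hk : 0 < k) : (peakIndex g k).card = g ^ (k - 1).choose 2 := by
  obtain ⟨k, rfl⟩ := Nat.exists_eq_succ_of_ne_zero hk.ne'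
  have h1 : Nat.card (boundary g k).ker = (peakIndex g (k + 1)).card := by
    rw [← Nat.card_eq_finsetCard]
    exact Nat.card_congr (Equiv.subtypeEquivRight mem_ker_boundary)
  have h2 := AddSubgroup.card_mul_index (boundary g k).ker
  rw [AddSubgroup.index_ker, AddMonoidHom.range_eq_top.2 boundary_surjective, h1] at h2
  simp only [AddSubgroup.card_top, Nat.card_eq_fintype_card, Fintype.card_fun, ZMod.card,
    card_pairs, Fintype.card_fin] at h2
  have h3 : (k + 1).choose 2 = k.choose 2 + k := by
    rw [Nat.choose_succ_succ' k 1, Nat.choose_one_right, add_comm]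
  rw [h3, pow_add] at h2
  exact Nat.eq_of_mul_eq_mul_right (pow_pos (NeZero.pos g) k) h2

end Peaks

/-! ### Stability of characters and decay away from the peaks -/

section AwayFromPeaks

lemma int_eq_zero_of_abs_two_pi_mul_lt {m : ℤ} (h : |2 * Real.pi * (m : ℝ)| < 2 * Real.pi) :
    m = 0 := by
  rw [abs_mul, abs_of_pos Real.two_pi_pos] at h
  have h1 : |(m : ℝ)| < 1 := by
    by_contra h2
    push Not at h2
    nlinarith [Real.two_pi_pos]
  exact Int.abs_lt_one_iff.1 (by exact_mod_cast h1)

variable {g k : ℕ} [NeZero g]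

/-- A function on `ZMod g` that is additive modulo `2π` and takes values in `ℝ` agrees modulo
`2π` with a character. -/
lemma exists_character (χ : ZMod g → ℝ)
    (h : ∀ u v, ∃ N : ℤ, χ (u + v) = χ u + χ v + 2 * Real.pi * N) :
    ∃ c : ZMod g, ∀ a, ∃ n : ℤ, χ a = 2 * Real.pi * ((c * a).val : ℝ) / g + 2 * Real.pi * n := by
  have hg : (g : ℝ) ≠ 0 := Nat.cast_ne_zero.2 (NeZero.ne g)
  have h0 : ∃ N : ℤ, χ 0 = 2 * Real.pi * N := by
    obtain ⟨N, hN⟩ := h 0 0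
    refine ⟨-N, ?_⟩
    rw [add_zero] at hN
    push_cast
    linarith
  have hn : ∀ n : ℕ, ∃ N : ℤ, χ (n : ZMod g) = n * χ 1 + 2 * Real.pi * N := by
    intro n
    induction n with
    | zero => simpa using h0
    | succ n ih =>
      obtain ⟨N, hN⟩ := ih
      obtain ⟨M, hM⟩ := h n 1
      refine ⟨N + M, ?_⟩
      push_cast
      rw [hM, hN]
      ring
  obtain ⟨m, hm⟩ : ∃ m : ℤ, g * χ 1 = 2 * Real.pi * m := by
    obtain ⟨N, hN⟩ := hn g
    obtain ⟨M, hM⟩ := h0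
    rw [ZMod.natCast_self] at hN
    refine ⟨M - N, ?_⟩
    push_cast
    linarith
  refine ⟨(m : ZMod g), fun a => ?_⟩
  obtain ⟨N, hN⟩ := hn a.val
  have h1 : ((m * a.val - (((m : ZMod g) * a).val : ℤ) : ℤ) : ZMod g) = 0 := by
    push_cast
    simp
  obtain ⟨r, hr⟩ := (ZMod.intCast_zmod_eq_zero_iff_dvd _ g).1 h1
  refine ⟨N + r, ?_⟩
  rw [ZMod.natCast_val, ZMod.cast_id'] at hN
  simp only [id_eq] at hN
  have h2 : χ 1 = 2 * Real.pi * m / g := by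
    rw [eq_div_iff hg]; linarith
  have hr' : (m : ℝ) * a.val - ((m : ZMod g) * a).val = g * r := by exact_mod_cast hr
  have h3 : (m : ℝ) * a.val = ((m : ZMod g) * a).val + g * r := by linarith
  rw [hN, h2]
  push_cast
  field_simp
  linear_combination h3

/-- Functions on `ZMod g` that are nearly additive modulo `2π` are close to characters. -/
lemma exists_character_near {δ : ℝ} (hδ : δ ≤ 1) (f : ZMod g → ℝ)
    (h : ∀ u w, ∃ N : ℤ, |f (u + w) - f u - f w - 2 * Real.pi * N| ≤ δ) :
    ∃ c : ZMod g, ∀ a, ∃ n : ℤ,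
      |f a - 2 * Real.pi * ((c * a).val : ℝ) / g - 2 * Real.pi * n| ≤ δ := by
  have hg : (0 : ℝ) < g := Nat.cast_pos.2 (NeZero.pos g)
  choose N hN using h
  set ε : ZMod g → ZMod g → ℝ := fun u w => f (u + w) - f u - f w - 2 * Real.pi * N u w with hε
  -- The cocycle identity holds modulo 2π. It is exact because four errors of size at most 1 sum to
  -- less than 2π.
  have hcoc : ∀ u v w, ε u v + ε (u + v) w = ε v w + ε u (v + w) := by
    intro u v w
    have h1 : ε u v + ε (u + v) w - ε v w - ε u (v + w) =
        2 * Real.pi * ((N v w + N u (v + w) - N u v - N (u + v) w : ℤ) : ℝ) := by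
      simp only [hε, add_assoc]; push_cast; ring
    have h2 : |ε u v + ε (u + v) w - ε v w - ε u (v + w)| < 2 * Real.pi := by
      have := Real.pi_gt_three
      have b1 := abs_le.1 (hN u v)
      have b2 := abs_le.1 (hN (u + v) w)
      have b3 := abs_le.1 (hN v w)
      have b4 := abs_le.1 (hN u (v + w))
      rw [abs_lt]
      constructor <;> linarith [b1.1, b1.2, b2.1, b2.2, b3.1, b3.2, b4.1, b4.2]
    rw [h1] at h2
    rw [int_eq_zero_of_abs_two_pi_mul_lt h2] at h1
    simp only [Int.cast_zero, mul_zero] at h1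
    linarith
  -- Averaging a real 2-cocycle over the group exhibits it as a coboundary without increasing its
  -- sup norm; `f + η` is then additive modulo 2π.
  set η : ZMod g → ℝ := fun u => (∑ w, ε u w) / g with hη
  have hη_le : ∀ u, |η u| ≤ δ := by
    intro u
    rw [hη, abs_div, abs_of_pos hg, div_le_iff₀ hg]
    refine (Finset.abs_sum_le_sum_abs _ _).trans ?_
    refine (Finset.sum_le_card_nsmul _ _ δ fun w _ => hN u w).trans_eq ?_
    rw [Finset.card_univ, ZMod.card, nsmul_eq_mul, mul_comm]
  have hη_add : ∀ u v, ε u v = η u + η v - η (u + v) := by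
    intro u v
    have h1 : ∑ w, (ε u v + ε (u + v) w) = ∑ w, (ε v w + ε u (v + w)) :=
      Finset.sum_congr rfl fun w _ => hcoc u v w
    have h2 : ∑ w, ε u (v + w) = ∑ w, ε u w := Equiv.sum_comp (Equiv.addLeft v) (ε u)
    rw [Finset.sum_add_distrib, Finset.sum_add_distrib, h2, Finset.sum_const, Finset.card_univ,
      ZMod.card, nsmul_eq_mul] at h1
    simp only [hη]
    field_simp
    linarith
  obtain ⟨c, hc⟩ := exists_character (fun u => f u + η u) fun u v => ⟨N u v, by
    have := hη_add u v
    simp only [hε] at this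
    linarith⟩
  refine ⟨c, fun a => ?_⟩
  obtain ⟨n, hn⟩ := hc a
  refine ⟨n, ?_⟩
  have h1 : f a - 2 * Real.pi * ((c * a).val : ℝ) / g - 2 * Real.pi * n = -η a := by linarith
  rw [h1, abs_neg]
  exact hη_le a

-- A pair other than `p` contains at most one of the two rows being changed, so its term cancels
-- (using `ext_zero`).
omit [NeZero g] in
lemma phase_second_difference (θ : Idx g k → ℝ) (p : Pairs k) (u w : ZMod g) :
    phase θ (Pi.single p.1.1 u + Pi.single p.1.2 (-w)) - phase θ (Pi.single p.1.1 u) -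
      phase θ (Pi.single p.1.2 (-w)) = ext θ p (u + w) - ext θ p u - ext θ p w := by
  simp only [phase]
  rw [← Finset.sum_sub_distrib, ← Finset.sum_sub_distrib, Finset.sum_eq_single p]
  · obtain ⟨⟨i, j⟩, hij⟩ := p
    simp only at hij
    simp [hij.ne, hij.ne']
  · intro q _ hqp
    obtain ⟨⟨i, j⟩, hij⟩ := p
    obtain ⟨⟨m, n⟩, hmn⟩ := q
    simp only at hij hmn
    simp only [Pi.add_apply, Pi.single_apply]
    have hqp' : ¬ (m = i ∧ n = j) := fun h => hqp (Subtype.ext (Prod.ext h.1 h.2))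
    by_cases h1 : m = i
    · have h2 : n ≠ j := fun h => hqp' ⟨h1, h⟩
      subst h1
      simp [h2, hij.ne, hmn.ne', ext_zero]
    · by_cases h3 : n = i
      · subst h3
        simp [h1, hij.ne, (hmn.trans hij).ne, ext_zero]
      · simp [h1, h3, ext_zero]
  · simp

/-- If the phase is nearly constant modulo `2π`, then the point is near a peak. -/
lemma exists_peak_near {δ : ℝ} (hδ : 0 < δ) (hδ' : g * ((k.choose 2 : ℝ) + 1) * δ ≤ 1)
    (θ : Idx g k → ℝ)
    (h : ∀ x y, ∃ n : ℤ, |phase θ x - phase θ y - 2 * Real.pi * n| ≤ δ / 2) :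
    ∃ c ∈ peakIndex g k, ∀ q, ∃ n : ℤ, |θ q - peak c q - 2 * Real.pi * n| ≤ δ := by
  have hg : (0 : ℝ) < g := Nat.cast_pos.2 (NeZero.pos g)
  have hg1 : (1 : ℝ) ≤ g := by exact_mod_cast NeZero.one_le
  have hC : (0 : ℝ) ≤ k.choose 2 := Nat.cast_nonneg _
  have hδ1 : δ ≤ 1 := by
    have : (1 : ℝ) ≤ g * ((k.choose 2 : ℝ) + 1) := by nlinarith
    nlinarith
  have hf : ∀ p : Pairs k, ∃ c : ZMod g, ∀ a, ∃ n : ℤ,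
      |ext θ p a - 2 * Real.pi * ((c * a).val : ℝ) / g - 2 * Real.pi * n| ≤ δ := by
    intro p
    refine exists_character_near hδ1 _ fun u w => ?_
    obtain ⟨n, hn⟩ := h (Pi.single p.1.1 u + Pi.single p.1.2 (-w)) (Pi.single p.1.1 u)
    obtain ⟨m, hm⟩ := h (Pi.single p.1.2 (-w)) 0
    refine ⟨n - m, ?_⟩
    rw [← phase_second_difference]
    rw [phase_zero] at hm
    push_cast
    have b1 := abs_le.1 hn
    have b2 := abs_le.1 hm
    rw [abs_le]
    constructor <;> linarith [b1.1, b1.2, b2.1, b2.2]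
  choose c hc using hf
  choose n hn using hc
  refine ⟨c, Finset.mem_filter.2 ⟨Finset.mem_univ _, fun x => ?_⟩, fun q => ?_⟩
  · obtain ⟨m, hm⟩ := h x 0
    rw [phase_zero, sub_zero] at hm
    set v : Pairs k → ℕ := fun p => (c p * (x p.1.1 - x p.1.2)).val with hv
    set N : ℤ := ∑ p, n p (x p.1.1 - x p.1.2) with hN
    have h1 : |phase θ x - 2 * Real.pi * ((∑ p, v p : ℕ) : ℝ) / g - 2 * Real.pi * N| ≤
        k.choose 2 * δ := by
      have h2 : phase θ x - 2 * Real.pi * ((∑ p, v p : ℕ) : ℝ) / g - 2 * Real.pi * N =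
          ∑ p : Pairs k, (ext θ p (x p.1.1 - x p.1.2) - 2 * Real.pi * (v p : ℝ) / g -
            2 * Real.pi * n p (x p.1.1 - x p.1.2)) := by
        rw [Finset.sum_sub_distrib, Finset.sum_sub_distrib, ← Finset.sum_div, ← Finset.mul_sum,
          ← Finset.mul_sum, hN]
        push_cast
        rfl
      rw [h2]
      refine (Finset.abs_sum_le_sum_abs _ _).trans ?_
      refine (Finset.sum_le_card_nsmul _ _ δ fun p _ => hn p _).trans_eq ?_
      rw [Finset.card_univ, card_pairs, nsmul_eq_mul]
    -- The left side is at most g(1/2 + C(k,2))δ ≤ 1, so the integer vanishes, and its reduction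
    -- modulo `g` is the required relation.
    have h3 : |2 * Real.pi * (((∑ p, v p : ℕ) + g * (N - m) : ℤ) : ℝ)| < 2 * Real.pi := by
      have h4 : 2 * Real.pi * (((∑ p, v p : ℕ) + g * (N - m) : ℤ) : ℝ) =
          g * ((phase θ x - 2 * Real.pi * m) -
            (phase θ x - 2 * Real.pi * ((∑ p, v p : ℕ) : ℝ) / g - 2 * Real.pi * N)) := by
        push_cast
        field_simp
        ring
      rw [h4, abs_mul, abs_of_pos hg]
      have h5 := abs_sub (phase θ x - 2 * Real.pi * m)
        (phase θ x - 2 * Real.pi * ((∑ p, v p : ℕ) : ℝ) / g - 2 * Real.pi * N)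
      have h6 := mul_le_mul_of_nonneg_left (h5.trans (add_le_add hm h1)) hg.le
      have := Real.pi_gt_three
      nlinarith
    have h7 := int_eq_zero_of_abs_two_pi_mul_lt h3
    have h8 := congrArg (Int.cast : ℤ → ZMod g) h7
    push_cast at h8
    simpa [hv] using h8
  · refine ⟨n q.1 q.2.1, ?_⟩
    have h1 := hn q.1 q.2.1
    have h2 : ext θ q.1 q.2.1 = θ q := by
      unfold ext
      rw [dif_pos q.2.2]
    rwa [h2] at h1

lemma exists_peak_mem_cube {δ : ℝ} (hδ : 0 < δ)
    (hδ' : g * ((k.choose 2 : ℝ) + 1) * δ ≤ 1) {θ : Idx g k → ℝ} (hθ : θ ∈ box g k)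
    (h : ∀ x y, ∃ n : ℤ, |phase θ x - phase θ y - 2 * Real.pi * n| ≤ δ / 2) :
    ∃ c ∈ peakIndex g k, θ - peak c ∈ cube g k δ := by
  have hg : (0 : ℝ) < g := Nat.cast_pos.2 (NeZero.pos g)
  have hC : (0 : ℝ) ≤ k.choose 2 := Nat.cast_nonneg _
  obtain ⟨c, hc, hn⟩ := exists_peak_near hδ hδ' θ h
  refine ⟨c, hc, fun q => abs_le.1 ?_⟩
  obtain ⟨n, hn⟩ := hn q
  have h1 : δ < Real.pi / g := by
    rw [lt_div_iff₀ hg]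
    have := Real.pi_gt_three
    nlinarith [mul_nonneg (mul_nonneg hg.le hC) hδ.le]
  have h2 := hθ q (Set.mem_univ _)
  have h3 := peak_nonneg c q
  have h4 := peak_le c q
  have h5 := abs_le.1 hn
  have h6 : n = 0 := by
    refine int_eq_zero_of_abs_two_pi_mul_lt (abs_lt.2 ⟨?_, ?_⟩) <;> linarith [h2.1, h2.2, h5.1, h5.2]
  rwa [h6, Int.cast_zero, mul_zero, sub_zero] at hn

/-- The modulus is 2|cos((α - β)/2)| ≤ 2 cos(δ/4) ≈ 2 - δ²/16. As 1/16 = 12/192, the constant 11/192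
leaves δ²/192 to absorb the quartic term. -/
lemma norm_exp_add_exp_le {δ : ℝ} (hδ : 0 < δ) (hδ' : δ ≤ 1) {α β : ℝ}
    (h : ∀ n : ℤ, δ / 2 < |α - β - 2 * Real.pi * n|) :
    ‖Complex.exp (Complex.I * α) + Complex.exp (Complex.I * β)‖ ≤ 2 - 11 / 192 * δ ^ 2 := by
  have hcos : Real.cos (α - β) ≤ Real.cos (δ / 2) := by
    set n : ℤ := round ((α - β) / (2 * Real.pi)) with hn
    have h1 := abs_sub_round ((α - β) / (2 * Real.pi))
    have h2 : |α - β - 2 * Real.pi * n| ≤ Real.pi := by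
      have h3 : α - β - 2 * Real.pi * n = 2 * Real.pi * ((α - β) / (2 * Real.pi) - n) := by
        field_simp
      rw [h3, abs_mul, abs_of_pos Real.two_pi_pos]
      nlinarith [Real.pi_pos]
    have h4 : Real.cos (α - β) = Real.cos |α - β - 2 * Real.pi * n| := by
      rw [Real.cos_abs, mul_comm (2 * Real.pi), Real.cos_sub_int_mul_two_pi]
    rw [h4]
    exact Real.cos_le_cos_of_nonneg_of_le_pi (by positivity) h2 (h n).le
  have hsq : ‖Complex.exp (Complex.I * α) + Complex.exp (Complex.I * β)‖ ^ 2 =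
      2 + 2 * Real.cos (α - β) := by
    rw [← Complex.normSq_eq_norm_sq, Complex.normSq_apply]
    simp only [mul_comm Complex.I, Complex.add_re, Complex.add_im, Complex.exp_ofReal_mul_I_re,
      Complex.exp_ofReal_mul_I_im, Real.cos_sub]
    nlinarith [Real.sin_sq_add_cos_sq α, Real.sin_sq_add_cos_sq β]
  have hc : Real.cos (δ / 2) = 2 * Real.cos (δ / 4) ^ 2 - 1 := by
    rw [← Real.cos_two_mul]; ring_nf
  have hpos : 0 ≤ Real.cos (δ / 4) :=
    Real.cos_nonneg_of_mem_Icc ⟨by linarith [Real.pi_gt_three], by linarith [Real.pi_gt_three]⟩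
  have h1 : ‖Complex.exp (Complex.I * α) + Complex.exp (Complex.I * β)‖ ≤
      2 * Real.cos (δ / 4) := by
    refine abs_le_of_sq_le_sq' ?_ (by positivity) |>.2
    rw [hsq]
    nlinarith
  have h2 := Real.cos_bound (x := δ / 4) (by rw [abs_of_pos (by positivity)]; linarith)
  rw [abs_of_pos (show 0 < δ / 4 by positivity)] at h2
  have h3 := (abs_le.1 h2).2
  have h4 : δ ^ 4 ≤ δ ^ 2 := pow_le_pow_of_le_one hδ.le hδ' (by norm_num)
  nlinarith

/-- Away from the peaks the powers of `stepChar` are small. -/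
theorem norm_stepChar_pow_le {δ : ℝ} (hδ : 0 < δ)
    (hδ' : g * ((k.choose 2 : ℝ) + 1) * δ ≤ 1) {θ : Idx g k → ℝ} (hθ : θ ∈ box g k)
    (h : ∀ c ∈ peakIndex g k, θ - peak c ∉ cube g k δ) (t : ℕ) :
    ‖stepChar g k θ ^ t‖ ≤ errorTerm g k t δ := by
  have hg : (0 : ℝ) < g := Nat.cast_pos.2 (NeZero.pos g)
  have hg1 : (1 : ℝ) ≤ g := by exact_mod_cast NeZero.one_le
  have hC : (0 : ℝ) ≤ k.choose 2 := Nat.cast_nonneg _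
  have hδ1 : δ ≤ 1 := by
    have : (1 : ℝ) ≤ g * ((k.choose 2 : ℝ) + 1) := by nlinarith
    nlinarith
  have h1 : ∃ x y, ∀ n : ℤ, δ / 2 < |phase θ x - phase θ y - 2 * Real.pi * n| := by
    by_contra! h2
    obtain ⟨c, hc, hcθ⟩ := exists_peak_mem_cube hδ hδ' hθ h2
    exact h c hc hcθ
  obtain ⟨x, y, hxy⟩ := h1
  have hne : x ≠ y := by
    rintro rfl
    have := hxy 0
    simp at this
    linarith
  have hxy' : ∀ n : ℤ, δ / 2 < |θ ⬝ᵥ Z g k x - θ ⬝ᵥ Z g k y - 2 * Real.pi * n| := by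
    intro n
    rw [dotProduct_Z, dotProduct_Z, sub_sub_sub_cancel_right]
    exact hxy n
  have h2 := norm_exp_add_exp_le hδ hδ1 hxy'
  -- Only the two columns `x`, `y` are used; every other term is bounded by 1.
  have h3 : ‖∑ x, Complex.exp (Complex.I * (θ ⬝ᵥ Z g k x : ℝ))‖ ≤
      (g : ℝ) ^ k - 11 / 192 * δ ^ 2 := by
    rw [← Finset.sum_compl_add_sum {x, y}, Finset.sum_pair hne]
    refine (norm_add_le _ _).trans ?_
    have h4 : ‖∑ x ∈ ({x, y} : Finset (Fin k → ZMod g))ᶜ,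
        Complex.exp (Complex.I * (θ ⬝ᵥ Z g k x : ℝ))‖ ≤ (g : ℝ) ^ k - 2 := by
      refine (norm_sum_le_of_le _ (n := fun _ => 1) fun z _ => ?_).trans ?_
      · rw [mul_comm, Complex.norm_exp_ofReal_mul_I]
      · have h5 := Finset.card_add_card_compl ({x, y} : Finset (Fin k → ZMod g))
        rw [Finset.card_pair hne] at h5
        simp only [Fintype.card_fun, Fintype.card_fin, ZMod.card] at h5
        have h6 : (2 : ℝ) + (({x, y} : Finset (Fin k → ZMod g))ᶜ.card : ℝ) = (g : ℝ) ^ k := by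
          exact_mod_cast h5
        simp only [Finset.sum_const, nsmul_eq_mul, mul_one]
        linarith
    linarith
  have hgk : (0 : ℝ) < (g : ℝ) ^ k := by positivity
  have h4 : ‖stepChar g k θ‖ ≤ Real.exp (-(11 / 192) * (g : ℝ) ^ (-(k : ℤ)) * δ ^ 2) := by
    refine le_trans ?_ (Real.add_one_le_exp _)
    rw [stepChar, norm_mul, norm_inv, norm_pow, Complex.norm_natCast, zpow_neg, zpow_natCast]
    refine (mul_le_mul_of_nonneg_left h3 (by positivity)).trans_eq ?_
    field_simp
    ring
  rw [norm_pow]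
  refine (pow_le_pow_left₀ (norm_nonneg _) h4 t).trans_eq ?_
  rw [← Real.exp_nat_mul, errorTerm]
  ring_nf

end AwayFromPeaks

/-! ### Gaussian integrals over cubes and their linear images -/

section Gaussian

lemma integral_gaussian_disc {b R : ℝ} (hb : 0 < b) (hR : 0 ≤ R) :
    ∫ p in {p : ℝ × ℝ | p.1 ^ 2 + p.2 ^ 2 ≤ R ^ 2}, Real.exp (-b * (p.1 ^ 2 + p.2 ^ 2)) =
      Real.pi / b * (1 - Real.exp (-b * R ^ 2)) := by
  have hm : MeasurableSet {p : ℝ × ℝ | p.1 ^ 2 + p.2 ^ 2 ≤ R ^ 2} :=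
    measurableSet_le (by fun_prop) (by fun_prop)
  rw [← integral_indicator hm, ← integral_comp_polarCoord_symm]
  have h1 : ∀ p ∈ polarCoord.target, p.1 • ({p : ℝ × ℝ | p.1 ^ 2 + p.2 ^ 2 ≤ R ^ 2}.indicator
      (fun p => Real.exp (-b * (p.1 ^ 2 + p.2 ^ 2))) (polarCoord.symm p)) =
      (Set.Iic R).indicator (fun r => r * Real.exp (-b * r ^ 2)) p.1 * 1 := by
    intro p hp
    have hp1 : 0 < p.1 := hp.1
    have h2 : (p.1 * Real.cos p.2) ^ 2 + (p.1 * Real.sin p.2) ^ 2 = p.1 ^ 2 := by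
      linear_combination p.1 ^ 2 * Real.sin_sq_add_cos_sq p.2
    have h3 : p.1 ^ 2 ≤ R ^ 2 ↔ p.1 ≤ R := pow_le_pow_iff_left₀ hp1.le hR two_ne_zero
    simp only [Set.indicator_apply, polarCoord_symm_apply, Set.mem_ofPred_eq, h2, h3, Set.mem_Iic,
      smul_eq_mul, mul_one, mul_ite, mul_zero]
  rw [setIntegral_congr_fun polarCoord.open_target.measurableSet h1, polarCoord_target,
    Measure.volume_eq_prod, setIntegral_prod_mul (fun r : ℝ => (Set.Iic R).indicator
      (fun r => r * Real.exp (-b * r ^ 2)) r) (fun _ : ℝ => (1 : ℝ))]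
  rw [setIntegral_indicator measurableSet_Iic, Set.Ioi_inter_Iic,
    ← intervalIntegral.integral_of_le hR]
  have h4 : ∀ r ∈ Set.uIcc 0 R, HasDerivAt (fun r => -(1 / (2 * b)) * Real.exp (-b * r ^ 2))
      (r * Real.exp (-b * r ^ 2)) r := by
    intro r _
    have h5 : HasDerivAt (fun r : ℝ => -b * r ^ 2) (-b * (2 * r)) r := by
      simpa using (hasDerivAt_pow 2 r).const_mul (-b)
    convert! (h5.exp.const_mul (-(1 / (2 * b)))) using 1
    field_simp
  rw [intervalIntegral.integral_eq_sub_of_hasDerivAt h4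
    (by apply Continuous.intervalIntegrable; fun_prop)]
  simp only [integral_const, MeasurableSet.univ, measureReal_restrict_apply, Set.univ_inter,
    smul_eq_mul, mul_one, Real.volume_real_Ioo_of_le (neg_le_self Real.pi_pos.le)]
  simp
  field_simp
  ring

lemma integrable_gaussian_plane {b : ℝ} (hb : 0 < b) :
    Integrable fun p : ℝ × ℝ => Real.exp (-b * (p.1 ^ 2 + p.2 ^ 2)) := by
  have h := (integrable_exp_neg_mul_sq hb).mul_prod (integrable_exp_neg_mul_sq hb)
  refine h.congr (Filter.Eventually.of_forall fun p => ?_)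
  simp only [← Real.exp_add]
  ring_nf

lemma sq_integral_gaussian_Icc (b r : ℝ) :
    (∫ y in Set.Icc (-r) r, Real.exp (-b * y ^ 2)) ^ 2 =
      ∫ p in Set.Icc (-r) r ×ˢ Set.Icc (-r) r, Real.exp (-b * (p.1 ^ 2 + p.2 ^ 2)) := by
  rw [sq, ← setIntegral_prod_mul, ← Measure.volume_eq_prod]
  simp only [← Real.exp_add, mul_add]

/-- The square contains its inscribed disc, on which polar coordinates evaluate the integral. -/
lemma le_sq_integral_gaussian_Icc {b r : ℝ} (hb : 0 < b) (hr : 0 ≤ r) :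
    Real.pi / b * (1 - Real.exp (-b * r ^ 2)) ≤
      (∫ y in Set.Icc (-r) r, Real.exp (-b * y ^ 2)) ^ 2 := by
  rw [sq_integral_gaussian_Icc, ← integral_gaussian_disc hb hr]
  refine setIntegral_mono_set (integrable_gaussian_plane hb).integrableOn
    (Filter.Eventually.of_forall fun p => (Real.exp_pos _).le) (LE.le.eventuallyLE ?_)
  intro p hp
  simp only [Set.mem_ofPred_eq] at hp
  exact ⟨abs_le.1 (abs_le_of_sq_le_sq (by nlinarith [sq_nonneg p.2]) hr),
    abs_le.1 (abs_le_of_sq_le_sq (by nlinarith [sq_nonneg p.1]) hr)⟩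

/-- The circumscribed disc has radius √2 r. This doubles the exponent, so that U has t(D₂δ)² where L
has (t/2)(D₁δ)². -/
lemma sq_integral_gaussian_Icc_le {b r : ℝ} (hb : 0 < b) (hr : 0 ≤ r) :
    (∫ y in Set.Icc (-r) r, Real.exp (-b * y ^ 2)) ^ 2 ≤
      Real.pi / b * (1 - Real.exp (-b * (2 * r ^ 2))) := by
  have h2 : (Real.sqrt 2 * r) ^ 2 = 2 * r ^ 2 := by
    rw [mul_pow, Real.sq_sqrt (by norm_num)]
  rw [sq_integral_gaussian_Icc, ← h2, ← integral_gaussian_disc hb (by positivity)]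
  refine setIntegral_mono_set (integrable_gaussian_plane hb).integrableOn
    (Filter.Eventually.of_forall fun p => (Real.exp_pos _).le) (LE.le.eventuallyLE ?_)
  intro p hp
  simp only [Set.mem_ofPred_eq, h2]
  have h3 := sq_le_sq' hp.1.1 hp.1.2
  have h4 := sq_le_sq' hp.2.1 hp.2.2
  linarith

variable {g k : ℕ} [NeZero g]

omit [NeZero g] in
lemma cube_eq_pi (r : ℝ) : cube g k r = Set.univ.pi fun _ => Set.Icc (-r) r := by
  ext θ
  exact Set.mem_univ_pi.symm

lemma measurableSet_cube (r : ℝ) : MeasurableSet (cube g k r) := by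
  rw [cube_eq_pi]
  exact MeasurableSet.univ_pi fun _ => measurableSet_Icc

omit [NeZero g] in
lemma isCompact_cube (r : ℝ) : IsCompact (cube g k r) := by
  rw [cube_eq_pi]
  exact isCompact_univ_pi fun _ => isCompact_Icc

lemma integral_gaussian_cube (b r : ℝ) :
    ∫ y in cube g k r, Real.exp (-b * (y ⬝ᵥ y)) =
      ((∫ y in Set.Icc (-r) r, Real.exp (-b * y ^ 2)) ^ 2) ^ ((dim g k : ℝ) / 2) := by
  have h1 : ∀ y : Idx g k → ℝ, Real.exp (-b * (y ⬝ᵥ y)) = ∏ c, Real.exp (-b * (y c) ^ 2) := by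
    intro y
    rw [← Real.exp_sum, ← Finset.mul_sum]
    simp [dotProduct, sq]
  simp only [h1]
  rw [cube_eq_pi, volume_pi, Measure.restrict_pi_pi,
    integral_fintype_prod_eq_pow (fun x : ℝ => Real.exp (-b * x ^ 2)), card_Idx]
  have h0 : 0 ≤ ∫ y in Set.Icc (-r) r, Real.exp (-b * y ^ 2) :=
    integral_nonneg fun y => (Real.exp_pos _).le
  rw [← Real.rpow_natCast _ 2, ← Real.rpow_mul h0, ← Real.rpow_natCast]
  congr 1
  push_cast
  ring

lemma le_integral_gaussian_cube {b r : ℝ} (hb : 0 < b) (hr : 0 ≤ r) :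
    (Real.pi / b) ^ ((dim g k : ℝ) / 2) * (1 - Real.exp (-b * r ^ 2)) ^ ((dim g k : ℝ) / 2) ≤
      ∫ y in cube g k r, Real.exp (-b * (y ⬝ᵥ y)) := by
  have h0 : 0 ≤ 1 - Real.exp (-b * r ^ 2) := by
    rw [sub_nonneg, Real.exp_le_one_iff]; nlinarith [sq_nonneg r]
  rw [integral_gaussian_cube, ← Real.mul_rpow (by positivity) h0]
  exact Real.rpow_le_rpow (by positivity) (le_sq_integral_gaussian_Icc hb hr) (by positivity)

lemma integral_gaussian_cube_le {b r : ℝ} (hb : 0 < b) (hr : 0 ≤ r) :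
    ∫ y in cube g k r, Real.exp (-b * (y ⬝ᵥ y)) ≤
      (Real.pi / b) ^ ((dim g k : ℝ) / 2) *
        (1 - Real.exp (-b * (2 * r ^ 2))) ^ ((dim g k : ℝ) / 2) := by
  have h0 : 0 ≤ 1 - Real.exp (-b * (2 * r ^ 2)) := by
    rw [sub_nonneg, Real.exp_le_one_iff]; nlinarith [sq_nonneg r]
  rw [integral_gaussian_cube, ← Real.mul_rpow (by positivity) h0]
  exact Real.rpow_le_rpow (by positivity) (sq_integral_gaussian_Icc_le hb hr) (by positivity)

lemma continuous_gaussian (b : ℝ) :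
    Continuous fun y : Idx g k → ℝ => Real.exp (-b * (y ⬝ᵥ y)) := by
  unfold dotProduct; fun_prop

lemma integral_gaussian_image {P : Matrix (Idx g k) (Idx g k) ℝ} (hP : P.det ≠ 0) (b : ℝ)
    {s : Set (Idx g k → ℝ)} (hs : MeasurableSet s) :
    ∫ y in P.mulVec '' s, Real.exp (-b * (y ⬝ᵥ y)) =
      |P.det| * ∫ θ in s, Real.exp (-b * (P.mulVec θ ⬝ᵥ P.mulVec θ)) := by
  set L : (Idx g k → ℝ) →L[ℝ] (Idx g k → ℝ) := LinearMap.toContinuousLinearMap (Matrix.toLin' P)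
    with hL
  have hLP : ∀ θ, L θ = P.mulVec θ := fun θ => by simp [hL]
  have hdet : L.det = P.det := by
    rw [ContinuousLinearMap.det, hL, LinearMap.coe_toContinuousLinearMap, LinearMap.det_toLin']
  have hinj : Function.Injective P.mulVec :=
    Matrix.mulVec_injective_iff_isUnit.2 ((Matrix.isUnit_iff_isUnit_det P).2 hP.isUnit)
  have h := integral_image_eq_integral_abs_det_fderiv_smul volume hs
    (f := P.mulVec) (f' := fun _ => L)
    (fun x _ => (L.hasFDerivWithinAt.congr (fun y _ => (hLP y).symm) (hLP x).symm))
    hinj.injOn (fun y => Real.exp (-b * (y ⬝ᵥ y)))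
  rw [h]
  simp only [hdet, smul_eq_mul]
  rw [integral_const_mul]

lemma dotProduct_mulVec_of_sq {P : Matrix (Idx g k) (Idx g k) ℝ} (hsymm : P.IsSymm)
    (hPP : P * P = covMatrix g k) (θ : Idx g k → ℝ) :
    P.mulVec θ ⬝ᵥ P.mulVec θ = θ ⬝ᵥ (covMatrix g k).mulVec θ := by
  rw [← hPP, ← Matrix.mulVec_mulVec, Matrix.dotProduct_mulVec θ, ← Matrix.mulVec_transpose,
    hsymm.eq]

lemma abs_det_of_sq {P : Matrix (Idx g k) (Idx g k) ℝ} (hPP : P * P = covMatrix g k) :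
    |P.det| = ((g : ℝ) ^ ((g : ℝ) / 2 * (k.choose 2 : ℝ)))⁻¹ := by
  have hg : (0 : ℝ) < g := Nat.cast_pos.2 (NeZero.pos g)
  rw [← abs_of_nonneg (show 0 ≤ ((g : ℝ) ^ ((g : ℝ) / 2 * (k.choose 2 : ℝ)))⁻¹ by positivity),
    ← sq_eq_sq_iff_abs_eq_abs, sq, ← Matrix.det_mul, hPP, det_covMatrix, inv_pow,
    ← Real.rpow_natCast _ 2, ← Real.rpow_mul hg.le, ← Real.rpow_natCast]
  congr 2
  push_cast
  ring

/-- The right side is the number of peaks times |det P|⁻¹ times the Gaussian integral over the whole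
space. -/
lemma mainTerm_eq {t : ℕ} (ht : 0 < t) :
    (2 * Real.pi) ^ dim g k * mainTerm g k t =
      (g : ℝ) ^ (k - 1).choose 2 * ((g : ℝ) ^ ((g : ℝ) / 2 * (k.choose 2 : ℝ)) *
        (Real.pi / (t / 2 : ℝ)) ^ ((dim g k : ℝ) / 2)) := by
  have hg : (0 : ℝ) < g := Nat.cast_pos.2 (NeZero.pos g)
  have ht' : (0 : ℝ) < t := Nat.cast_pos.2 ht
  have h1 : (Real.pi / (t / 2 : ℝ)) ^ ((dim g k : ℝ) / 2) =
      Real.sqrt ((2 * Real.pi / t) ^ dim g k) := by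
    rw [Real.sqrt_eq_rpow, ← Real.rpow_natCast, ← Real.rpow_mul (by positivity)]
    congr 1
    · field_simp
    · ring
  have h2 : Real.sqrt ((2 * Real.pi / t) ^ dim g k) * Real.sqrt ((2 * Real.pi * t) ^ dim g k) =
      (2 * Real.pi) ^ dim g k := by
    rw [← Real.sqrt_mul (by positivity), ← mul_pow]
    have h3 : 2 * Real.pi / t * (2 * Real.pi * t) = (2 * Real.pi) ^ 2 := by field_simp
    rw [h3, pow_right_comm, Real.sqrt_sq (by positivity)]
  rw [h1, mainTerm, Real.rpow_add hg, Real.rpow_natCast, ← h2]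
  have h4 : 0 < Real.sqrt ((2 * Real.pi * t) ^ dim g k) := Real.sqrt_pos.2 (by positivity)
  field_simp

/-- The Gaussian integral over a cube, in terms of the constants of `CubeConstants`. -/
theorem gaussian_integral_bounds {D₁ D₂ δ : ℝ} (hD : CubeConstants g k D₁ D₂) (hδ : 0 < δ)
    {t : ℕ} (ht : 0 < t) :
    (2 * Real.pi) ^ dim g k * mainTerm g k t *
        (1 - Real.exp (-((t : ℝ) / 2) * (D₁ * δ) ^ 2)) ^ ((dim g k : ℝ) / 2) ≤
      (g : ℝ) ^ (k - 1).choose 2 *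
        ∫ θ in cube g k δ, Real.exp (-((t : ℝ) / 2) * (θ ⬝ᵥ (covMatrix g k).mulVec θ)) ∧
    (g : ℝ) ^ (k - 1).choose 2 *
        ∫ θ in cube g k δ, Real.exp (-((t : ℝ) / 2) * (θ ⬝ᵥ (covMatrix g k).mulVec θ)) ≤
      (2 * Real.pi) ^ dim g k * mainTerm g k t *
        (1 - Real.exp (-(t : ℝ) * (D₂ * δ) ^ 2)) ^ ((dim g k : ℝ) / 2) := by
  obtain ⟨hD₁, hD₂, P, hsymm, hPP, hcube⟩ := hD
  have hg : (0 : ℝ) < g := Nat.cast_pos.2 (NeZero.pos g)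
  have hb : (0 : ℝ) < t / 2 := by positivity
  have hdet := abs_det_of_sq hPP
  have hq : 0 < (g : ℝ) ^ ((g : ℝ) / 2 * (k.choose 2 : ℝ)) := by positivity
  have hdet0 : P.det ≠ 0 := by rw [← abs_pos, hdet]; positivity
  have himg := integral_gaussian_image hdet0 (t / 2 : ℝ) (measurableSet_cube (g := g) (k := k) δ)
  simp only [dotProduct_mulVec_of_sq hsymm hPP] at himg
  rw [hdet, inv_mul_eq_div, eq_div_iff hq.ne'] at himg
  have hint : ∀ s : Set (Idx g k → ℝ), s ⊆ cube g k (D₂ * δ) →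
      IntegrableOn (fun y : Idx g k → ℝ => Real.exp (-(t / 2 : ℝ) * (y ⬝ᵥ y))) s := fun s hs =>
    ((continuous_gaussian _).continuousOn.integrableOn_compact (isCompact_cube _)).mono_set hs
  obtain ⟨hsub₁, hsub₂⟩ := hcube δ hδ
  have hpos : ∀ s : Set (Idx g k → ℝ), 0 ≤ᵐ[volume.restrict s]
      fun y : Idx g k → ℝ => Real.exp (-(t / 2 : ℝ) * (y ⬝ᵥ y)) := fun s =>
    Filter.Eventually.of_forall fun y => (Real.exp_pos _).le
  have hlow := (le_integral_gaussian_cube hb (by positivity)).trans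
    (setIntegral_mono_set (hint _ hsub₂) (hpos _) hsub₁.eventuallyLE)
  have hup := (setIntegral_mono_set (hint _ subset_rfl) (hpos _) hsub₂.eventuallyLE).trans
    (integral_gaussian_cube_le hb (by positivity))
  have h2 : -(t / 2 : ℝ) * (2 * (D₂ * δ) ^ 2) = -(t : ℝ) * (D₂ * δ) ^ 2 := by ring
  rw [h2] at hup
  rw [← himg, mainTerm_eq ht]
  constructor
  · calc _ = (g : ℝ) ^ (k - 1).choose 2 * (((Real.pi / (t / 2 : ℝ)) ^ ((dim g k : ℝ) / 2) *
          (1 - Real.exp (-((t : ℝ) / 2) * (D₁ * δ) ^ 2)) ^ ((dim g k : ℝ) / 2)) *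
            (g : ℝ) ^ ((g : ℝ) / 2 * (k.choose 2 : ℝ))) := by ring
      _ ≤ _ := by gcongr
  · calc _ ≤ (g : ℝ) ^ (k - 1).choose 2 * (((Real.pi / (t / 2 : ℝ)) ^ ((dim g k : ℝ) / 2) *
          (1 - Real.exp (-(t : ℝ) * (D₂ * δ) ^ 2)) ^ ((dim g k : ℝ) / 2)) *
            (g : ℝ) ^ ((g : ℝ) / 2 * (k.choose 2 : ℝ))) := by gcongr
      _ = _ := by ring

end Gaussian

/-! ### Second-order expansion near the origin -/

section NearPeaks

/-- Follows from e^u ≥ 1 + u + u²/2 and (1 - u + u²/2)(1 + u + u²/2) = 1 + u⁴/4. -/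
lemma exp_neg_le {u : ℝ} (hu : 0 ≤ u) : Real.exp (-u) ≤ 1 - u + u ^ 2 / 2 := by
  have h1 := Real.quadratic_le_exp_of_nonneg hu
  have h2 : 0 < 1 - u + u ^ 2 / 2 := by nlinarith [sq_nonneg (u - 1)]
  rw [Real.exp_neg, inv_le_comm₀ (Real.exp_pos _) h2]
  refine le_trans ?_ h1
  rw [inv_le_iff_one_le_mul₀ h2]
  nlinarith [sq_nonneg (u ^ 2)]

/-- The right side is tan |arg z|. -/
lemma abs_arg_le {z : ℂ} (hz : 0 < z.re) : |z.arg| ≤ |z.im| / z.re := by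
  have h1 : |z.arg| < Real.pi / 2 := Complex.abs_arg_lt_pi_div_two_iff.2 (Or.inl hz)
  have h2 := Real.le_tan (abs_nonneg _) h1
  rcases abs_cases z.arg with ⟨h, h'⟩ | ⟨h, h'⟩
  · rw [h, Complex.tan_arg] at h2
    rw [h]
    exact h2.trans (div_le_div_of_nonneg_right (le_abs_self _) hz.le)
  · rw [h, Real.tan_neg, Complex.tan_arg, ← neg_div] at h2
    rw [h]
    exact h2.trans (div_le_div_of_nonneg_right (neg_le_abs _) hz.le)

/-- Bounds for the powers of a complex number close to `1 - u`. -/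
lemma norm_pow_le_of_near {z : ℂ} {u s : ℝ} (hs : 0 ≤ s) (hs' : s ≤ 1 / 8)
    (hus : u ≤ s ^ 2 / 2) (hre : 1 - u ≤ z.re) (hre' : z.re ≤ 1 - u + s ^ 4 / 12)
    (him : |z.im| ≤ s ^ 3 / 5) (t : ℕ) :
    ‖z ^ t‖ ≤ (1 + 1 / 4 * s ^ 6) ^ ((t : ℝ) / 2) * (1 + 1 / 3 * s ^ 4) ^ t *
      Real.exp (-(t : ℝ) * u) := by
  have hs2 : s ^ 2 ≤ 1 / 64 := by nlinarith
  have he := Real.add_one_le_exp (-u)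
  have hz : 9 / 10 ≤ z.re := by linarith
  have h1 : z.re ≤ Real.exp (-u) * (1 + 1 / 3 * s ^ 4) := by
    have h4 : 0 ≤ s ^ 4 := by positivity
    nlinarith
  -- The squared imaginary part is at most s⁶/25, and z.re² ≥ 81/100.
  have h2 : ‖z‖ ^ 2 ≤ (1 + 1 / 4 * s ^ 6) * z.re ^ 2 := by
    rw [← Complex.normSq_eq_norm_sq, Complex.normSq_apply]
    have h3 : z.im ^ 2 ≤ (s ^ 3 / 5) ^ 2 := sq_le_sq' (abs_le.1 him).1 (abs_le.1 him).2
    have h6 : 0 ≤ s ^ 6 := by positivity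
    have h7 : 81 / 100 ≤ z.re ^ 2 := by nlinarith
    have h8 : (s ^ 3 / 5) ^ 2 = s ^ 6 / 25 := by ring
    nlinarith
  have h3 : ‖z‖ ≤ Real.sqrt (1 + 1 / 4 * s ^ 6) * (1 + 1 / 3 * s ^ 4) * Real.exp (-u) := by
    refine (abs_le_of_sq_le_sq' ?_ (by positivity)).2
    rw [mul_assoc, mul_pow, Real.sq_sqrt (by positivity)]
    refine h2.trans (mul_le_mul_of_nonneg_left ?_ (by positivity))
    refine pow_le_pow_left₀ (by linarith) ?_ 2
    linarith
  rw [norm_pow]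
  refine (pow_le_pow_left₀ (norm_nonneg _) h3 t).trans_eq ?_
  rw [mul_pow, mul_pow, ← Real.exp_nat_mul, Real.sqrt_eq_rpow, ← Real.rpow_natCast,
    ← Real.rpow_mul (by positivity)]
  ring_nf

lemma le_re_pow_of_near {z : ℂ} {u s : ℝ} (hs : 0 ≤ s) (hs' : s ≤ 1 / 8) (hu : 0 ≤ u)
    (hus : u ≤ s ^ 2 / 2) (hre : 1 - u ≤ z.re) (him : |z.im| ≤ s ^ 3 / 5) {t : ℕ}
    (ht : t * s ^ 3 ≤ 2) :
    (1 + (t : ℝ) ^ 2 * s ^ 6) ^ (-(1 / 2) : ℝ) * (1 - 1 / 3 * s ^ 4) ^ t *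
      Real.exp (-(t : ℝ) * u) ≤ (z ^ t).re := by
  have hs2 : s ^ 2 ≤ 1 / 64 := by nlinarith
  have hs4 : s ^ 4 ≤ 1 / 64 := by nlinarith [sq_nonneg (s ^ 2)]
  have hz : 9 / 10 ≤ z.re := by linarith
  have h1 : (1 - 1 / 3 * s ^ 4) * Real.exp (-u) ≤ ‖z‖ := by
    refine le_trans ?_ (hre.trans (Complex.re_le_norm z))
    have he := exp_neg_le hu
    have he' := Real.add_one_le_exp (-u)
    have h4 : 0 ≤ s ^ 4 := by positivity
    have h5 : u ^ 2 ≤ s ^ 4 / 4 := by nlinarith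
    nlinarith
  have h2 : ((1 - 1 / 3 * s ^ 4) * Real.exp (-u)) ^ t ≤ ‖z‖ ^ t :=
    pow_le_pow_left₀ (mul_nonneg (by linarith) (Real.exp_pos _).le) h1 t
  have harg : |z.arg| ≤ s ^ 3 / 4 := by
    refine (abs_arg_le (by linarith)).trans ?_
    rw [div_le_iff₀ (by linarith)]
    have h3 : 0 ≤ s ^ 3 := by positivity
    nlinarith
  set w := (t : ℝ) * s ^ 3 with hw
  have hw0 : 0 ≤ w := by positivity
  have h3 : (z ^ t).re = ‖z‖ ^ t * Real.cos (t * z.arg) := by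
    conv_lhs => rw [← Complex.norm_mul_exp_arg_mul_I z]
    rw [mul_pow, ← Complex.exp_nat_mul]
    have h4 : (t : ℂ) * (z.arg * Complex.I) = ((t * z.arg : ℝ) : ℂ) * Complex.I := by
      push_cast; ring
    rw [h4, ← Complex.ofReal_pow, Complex.re_ofReal_mul, Complex.exp_ofReal_mul_I_re]
  -- Here |t arg z| ≤ w/4, so the cosine is at least 1 - w²/32, which exceeds (1 + w²)^(-1/2) for w
  -- ≤ 2. This is where the bound on t s³ enters.
  have h4 : (1 + w ^ 2) ^ (-(1 / 2) : ℝ) ≤ Real.cos (t * z.arg) := by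
    refine le_trans ?_ (Real.one_sub_sq_div_two_le_cos)
    have h5 : (t * z.arg) ^ 2 ≤ (w / 4) ^ 2 := by
      rw [sq_le_sq, abs_mul, Nat.abs_cast, abs_of_nonneg (by positivity : 0 ≤ w / 4), hw]
      nlinarith [(Nat.cast_nonneg t : (0 : ℝ) ≤ t)]
    have hw2 : w ^ 2 ≤ 4 := by nlinarith
    rw [Real.rpow_neg (by positivity), ← Real.sqrt_eq_rpow]
    rw [inv_le_iff_one_le_mul₀ (Real.sqrt_pos.2 (by positivity))]
    have h6 : 1 ≤ (1 - w ^ 2 / 32) * Real.sqrt (1 + w ^ 2) := by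
      have h7 : 0 ≤ 1 - w ^ 2 / 32 := by linarith
      refine (abs_le_of_sq_le_sq' ?_ (mul_nonneg h7 (Real.sqrt_nonneg _))).2
      rw [mul_pow, Real.sq_sqrt (by positivity)]
      nlinarith [mul_nonneg (sq_nonneg w) (sq_nonneg w), sq_nonneg w,
        mul_nonneg (sq_nonneg w) (mul_nonneg (sq_nonneg w) (sq_nonneg w))]
    refine h6.trans (mul_le_mul_of_nonneg_right ?_ (Real.sqrt_nonneg _))
    linarith
  have h5 : (t : ℝ) ^ 2 * s ^ 6 = w ^ 2 := by rw [hw]; ring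
  have h6 : (1 - 1 / 3 * s ^ 4) ^ t * Real.exp (-(t : ℝ) * u) =
      ((1 - 1 / 3 * s ^ 4) * Real.exp (-u)) ^ t := by
    rw [mul_pow, ← Real.exp_nat_mul]; ring_nf
  rw [h3, h5, mul_assoc, h6, mul_comm]
  exact mul_le_mul h2 h4 (by positivity) (by positivity)

lemma cos_le {x : ℝ} (hx : |x| ≤ 1) : Real.cos x ≤ 1 - x ^ 2 / 2 + x ^ 4 / 12 := by
  have h1 := (abs_le.1 (Real.cos_bound hx)).2
  have h2 : |x| ^ 4 = x ^ 4 := by rw [← abs_pow, abs_of_nonneg (by positivity)]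
  have h3 : 0 ≤ x ^ 4 := by positivity
  rw [h2] at h1
  linarith

lemma abs_sin_sub_le {x s : ℝ} (hx : |x| ≤ s) (hs : s ≤ 1 / 8) : |Real.sin x - x| ≤ s ^ 3 / 5 := by
  have h0 := abs_nonneg x
  have h1 := Real.sin_bound (x := x) (by linarith)
  have h2 : |Real.sin x - x| ≤ |Real.sin x - (x - x ^ 3 / 6)| + |x ^ 3 / 6| := by
    have h := abs_sub (Real.sin x - (x - x ^ 3 / 6)) (x ^ 3 / 6)
    rwa [sub_sub, sub_add_cancel] at h
  have h3 : |x ^ 3 / 6| = |x| ^ 3 / 6 := by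
    rw [abs_div, abs_pow]; norm_num
  have h4 : |x| ^ 3 ≤ s ^ 3 := by gcongr
  have h5 : |x| ^ 5 ≤ |x| ^ 3 := pow_le_pow_of_le_one h0 (by linarith) (by norm_num)
  rw [h3] at h2
  nlinarith

variable {g k : ℕ} [NeZero g]

lemma stepChar_re (θ : Idx g k → ℝ) :
    (stepChar g k θ).re = ((g : ℝ) ^ k)⁻¹ * ∑ x, Real.cos (θ ⬝ᵥ Z g k x) := by
  have h : ((g : ℂ) ^ k)⁻¹ = ((((g : ℝ) ^ k)⁻¹ : ℝ) : ℂ) := by push_cast; rfl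
  rw [stepChar, h, Complex.re_ofReal_mul, Complex.re_sum]
  simp only [mul_comm Complex.I, Complex.exp_ofReal_mul_I_re]

lemma stepChar_im (θ : Idx g k → ℝ) :
    (stepChar g k θ).im = ((g : ℝ) ^ k)⁻¹ * ∑ x, Real.sin (θ ⬝ᵥ Z g k x) := by
  have h : ((g : ℂ) ^ k)⁻¹ = ((((g : ℝ) ^ k)⁻¹ : ℝ) : ℂ) := by push_cast; rfl
  rw [stepChar, h, Complex.im_ofReal_mul, Complex.im_sum]
  simp only [mul_comm Complex.I, Complex.exp_ofReal_mul_I_im]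

lemma sum_const_columns (a : ℝ) : ∑ _x : Fin k → ZMod g, a = (g : ℝ) ^ k * a := by
  simp

/-- Expansion of `stepChar` to second order on a small cube. -/
lemma stepChar_near {δ : ℝ} {θ : Idx g k → ℝ} (hθ : θ ∈ cube g k δ)
    (hs' : (dim g k : ℝ) * δ ≤ 1 / 8) :
    0 ≤ θ ⬝ᵥ (covMatrix g k).mulVec θ ∧
    θ ⬝ᵥ (covMatrix g k).mulVec θ ≤ (dim g k * δ) ^ 2 ∧
    1 - θ ⬝ᵥ (covMatrix g k).mulVec θ / 2 ≤ (stepChar g k θ).re ∧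
    (stepChar g k θ).re ≤ 1 - θ ⬝ᵥ (covMatrix g k).mulVec θ / 2 + (dim g k * δ) ^ 4 / 12 ∧
    |(stepChar g k θ).im| ≤ (dim g k * δ) ^ 3 / 5 := by
  have hg : (0 : ℝ) < g := Nat.cast_pos.2 (NeZero.pos g)
  have hgk : (0 : ℝ) < (g : ℝ) ^ k := by positivity
  have hsq := sum_dotProduct_Z_sq θ
  have hmean := sum_dotProduct_Z θ
  have hX := abs_dotProduct_Z_le hθ
  set s := (dim g k : ℝ) * δ with hs
  set σ := θ ⬝ᵥ (covMatrix g k).mulVec θ with hσ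
  have hX2 : ∀ x, (θ ⬝ᵥ Z g k x) ^ 2 ≤ s ^ 2 := fun x =>
    sq_le_sq' (abs_le.1 (hX x)).1 (abs_le.1 (hX x)).2
  refine ⟨?_, ?_, ?_, ?_, ?_⟩
  · have h1 : 0 ≤ (g : ℝ) ^ k * σ := hsq ▸ Finset.sum_nonneg fun x _ => sq_nonneg _
    exact nonneg_of_mul_nonneg_right h1 hgk
  · have h1 : (g : ℝ) ^ k * σ ≤ (g : ℝ) ^ k * s ^ 2 := by
      rw [← hsq, ← sum_const_columns]
      exact Finset.sum_le_sum fun x _ => hX2 x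
    exact le_of_mul_le_mul_left h1 hgk
  · rw [stepChar_re, inv_mul_eq_div, le_div_iff₀ hgk]
    have h1 : (1 - σ / 2) * (g : ℝ) ^ k = ∑ x, (1 - (θ ⬝ᵥ Z g k x) ^ 2 / 2) := by
      rw [Finset.sum_sub_distrib, ← Finset.sum_div, hsq, sum_const_columns]
      ring
    rw [h1]
    exact Finset.sum_le_sum fun x _ => Real.one_sub_sq_div_two_le_cos
  · rw [stepChar_re, inv_mul_eq_div, div_le_iff₀ hgk]
    have h1 : (1 - σ / 2 + s ^ 4 / 12) * (g : ℝ) ^ k =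
        ∑ x, (1 - (θ ⬝ᵥ Z g k x) ^ 2 / 2 + s ^ 4 / 12) := by
      rw [Finset.sum_add_distrib, Finset.sum_sub_distrib, ← Finset.sum_div, hsq,
        sum_const_columns, sum_const_columns]
      ring
    rw [h1]
    refine Finset.sum_le_sum fun x _ => (cos_le ((hX x).trans (by linarith))).trans ?_
    have h2 : (θ ⬝ᵥ Z g k x) ^ 4 ≤ s ^ 4 := by
      have := pow_le_pow_left₀ (sq_nonneg _) (hX2 x) 2
      rwa [← pow_mul, ← pow_mul] at this
    linarith
  · rw [stepChar_im, abs_mul, abs_of_pos (inv_pos.2 hgk), inv_mul_eq_div, div_le_iff₀ hgk]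
    -- Mean zero removes the linear term, leaving an imaginary part of third order.
    have h1 : ∑ x, Real.sin (θ ⬝ᵥ Z g k x) =
        ∑ x, (Real.sin (θ ⬝ᵥ Z g k x) - θ ⬝ᵥ Z g k x) := by
      rw [Finset.sum_sub_distrib, hmean, sub_zero]
    rw [h1, mul_comm, ← sum_const_columns]
    exact (Finset.abs_sum_le_sum_abs _ _).trans
      (Finset.sum_le_sum fun x _ => abs_sin_sub_le (hX x) hs')

end NearPeaks

/-! ### Localization to the peaks and conclusion -/

section Assembly

variable {g k : ℕ} [NeZero g]

lemma continuous_stepChar : Continuous (stepChar g k) := by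
  unfold stepChar dotProduct; fun_prop

/-- The integral over the fundamental domain is concentrated on the cubes around the peaks. -/
theorem integral_box_sub_le (hg : 2 ≤ g) {δ : ℝ} (hδ : 0 < δ)
    (hδ' : g * ((k.choose 2 : ℝ) + 1) * δ ≤ 1) {t : ℕ} (hgt : g ∣ t)
    (hpar : Odd g ∨ (Even g ∧ Even (t / g))) :
    ‖(∫ θ in box g k, stepChar g k θ ^ t) -
      (peakIndex g k).card * ∫ θ in cube g k δ, stepChar g k θ ^ t‖ ≤
        (2 * Real.pi) ^ dim g k * errorTerm g k t δ := by
  have hg0 : (0 : ℝ) < g := Nat.cast_pos.2 (NeZero.pos g)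
  have hC : (0 : ℝ) ≤ k.choose 2 := Nat.cast_nonneg _
  have hδg : δ < Real.pi / g := by
    rw [lt_div_iff₀ hg0]
    have := Real.pi_gt_three
    nlinarith [mul_nonneg (mul_nonneg hg0.le hC) hδ.le]
  set A : (Pairs k → ZMod g) → Set (Idx g k → ℝ) := fun c => {θ | θ - peak c ∈ cube g k δ} with hA
  have hAm : ∀ c, MeasurableSet (A c) := fun c =>
    (measurable_id.sub_const (peak c)) (measurableSet_cube δ)
  -- The left end -π/g of `box` serves this purpose: peak coordinates lie in [0, 2π - 2π/g], leaving
  -- a margin π/g > δ on both sides.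
  have hAbox : ∀ c, A c ⊆ box g k := by
    intro c θ hθ q _
    have h1 := hθ q
    simp only [Pi.sub_apply, Set.mem_Icc] at h1
    have h2 := peak_nonneg c q
    have h3 := peak_le c q
    constructor <;> linarith [h1.1, h1.2]
  have hdisj : (peakIndex g k : Set (Pairs k → ZMod g)).Pairwise (Function.onFun Disjoint A) := by
    intro c _ c' _ hcc
    rw [Function.onFun, Set.disjoint_left]
    intro θ h1 h2
    obtain ⟨q, hq⟩ := exists_peak_sub hg hcc
    have h3 := h1 q
    have h4 := h2 q
    simp only [Pi.sub_apply, Set.mem_Icc] at h3 h4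
    rcases abs_cases (peak c q - peak c' q) with ⟨h, -⟩ | ⟨h, -⟩ <;>
      linarith [h3.1, h3.2, h4.1, h4.2]
  have hFc : Continuous fun θ => stepChar g k θ ^ t := continuous_stepChar.pow t
  have hcompact : IsCompact (Set.univ.pi fun _ : Idx g k =>
      Set.Icc (-(Real.pi / g)) (-(Real.pi / g) + 2 * Real.pi)) :=
    isCompact_univ_pi fun _ => isCompact_Icc
  have hint : IntegrableOn (fun θ => stepChar g k θ ^ t) (box g k) :=
    (hFc.continuousOn.integrableOn_compact hcompact).mono_set
      (Set.pi_mono fun _ _ => Set.Ioc_subset_Icc_self)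
  have hAint : ∀ c ∈ peakIndex g k, ∫ θ in A c, stepChar g k θ ^ t =
      ∫ θ in cube g k δ, stepChar g k θ ^ t := by
    intro c hc
    rw [← integral_indicator (hAm c), ← integral_indicator (measurableSet_cube δ),
      ← integral_add_left_eq_self _ (peak c)]
    congr 1
    funext θ
    have hmem : peak c + θ ∈ A c ↔ θ ∈ cube g k δ := by
      simp only [hA, Set.mem_ofPred_eq, add_sub_cancel_left]
    by_cases h : θ ∈ cube g k δ
    · rw [Set.indicator_of_mem h, Set.indicator_of_mem (hmem.2 h),
        stepChar_peak_add_pow hc θ hgt hpar]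
    · rw [Set.indicator_of_notMem h, Set.indicator_of_notMem fun h' => h (hmem.1 h')]
  set V := ⋃ c ∈ peakIndex g k, A c with hV
  have hVm : MeasurableSet V := Finset.measurableSet_biUnion _ fun c _ => hAm c
  have hVbox : V ⊆ box g k := Set.iUnion₂_subset fun c _ => hAbox c
  have hVint : ∫ θ in V, stepChar g k θ ^ t =
      (peakIndex g k).card * ∫ θ in cube g k δ, stepChar g k θ ^ t := by
    rw [hV, integral_biUnion_finset _ (fun c _ => hAm c) hdisj
      (fun c _ => hint.mono_set (hAbox c)), Finset.sum_congr rfl hAint, Finset.sum_const,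
      nsmul_eq_mul]
  rw [← hVint, ← setIntegral_sdiff hVm hint hVbox]
  have hvol : volume (box g k) < ⊤ := by rw [volume_box]; exact ENNReal.ofReal_lt_top
  have hvol' : volume.real (box g k \ V) ≤ (2 * Real.pi) ^ dim g k := by
    have h1 : volume.real (box g k) = (2 * Real.pi) ^ dim g k := by
      rw [measureReal_def, volume_box, ENNReal.toReal_ofReal (by positivity)]
    rw [← h1]
    exact measureReal_mono Set.sdiff_subset hvol.ne
  refine (norm_setIntegral_le_of_norm_le_const (C := errorTerm g k t δ)
    ((measure_mono Set.sdiff_subset).trans_lt hvol) ?_).trans ?_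
  · intro θ hθ
    refine norm_stepChar_pow_le hδ hδ' hθ.1 (fun c hc hcθ => hθ.2 ?_) t
    exact Set.mem_iUnion₂.2 ⟨c, hc, hcθ⟩
  · rw [mul_comm]
    exact mul_le_mul_of_nonneg_right hvol' (Real.exp_pos _).le

-- For k ≥ 2 the hypothesis gives g k² δ ≤ (8/5)(1/16) = 1/10, and both quantities are at most g k²
-- δ.
omit [NeZero g] in
lemma radius_bounds (hg : 2 ≤ g) (hk : 2 ≤ k) {δ : ℝ} (hδ : 0 < δ)
    (hδ' : δ < 8 / 5 * (g : ℝ) ^ (-(k : ℤ) - 3) * (k : ℝ) ^ (-2 : ℤ)) :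
    g * ((k.choose 2 : ℝ) + 1) * δ ≤ 1 ∧ (dim g k : ℝ) * δ ≤ 1 / 8 := by
  have hg2 : (2 : ℝ) ≤ g := by exact_mod_cast hg
  have hk2 : (2 : ℝ) ≤ k := by exact_mod_cast hk
  have h1 : (g : ℝ) ^ (-(k : ℤ) - 3) ≤ 1 / (16 * g) := by
    have h2 : (g : ℝ) ^ (-(k : ℤ) - 3) ≤ (g : ℝ) ^ (-5 : ℤ) :=
      zpow_le_zpow_right₀ (by linarith) (by lia)
    refine h2.trans ?_
    have h3 : (g : ℝ) ^ (-5 : ℤ) = 1 / (g ^ 4 * g) := by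
      rw [zpow_neg, one_div, ← pow_succ]; norm_cast
    rw [h3]
    have h4 : (16 : ℝ) ≤ g ^ 4 := by
      calc (16 : ℝ) = 2 ^ 4 := by norm_num
        _ ≤ _ := by gcongr
    gcongr
  have h2 : (k : ℝ) ^ (-2 : ℤ) = 1 / (k : ℝ) ^ 2 := by
    rw [zpow_neg, one_div]; norm_cast
  have h3 : g * (k : ℝ) ^ 2 * δ ≤ 1 / 10 := by
    have h4 : δ ≤ 8 / 5 * (1 / (16 * g)) * (1 / (k : ℝ) ^ 2) := by
      rw [h2] at hδ'
      refine hδ'.le.trans ?_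
      gcongr
    calc g * (k : ℝ) ^ 2 * δ ≤ g * (k : ℝ) ^ 2 * (8 / 5 * (1 / (16 * g)) * (1 / (k : ℝ) ^ 2)) := by
          gcongr
      _ = 1 / 10 := by field_simp; norm_num
  have hC : (k.choose 2 : ℝ) = k * (k - 1) / 2 := Nat.cast_choose_two ℝ k
  have hd : (dim g k : ℝ) ≤ g * (k : ℝ) ^ 2 := by
    rw [dim, Nat.cast_mul, Nat.cast_sub (by lia), hC, Nat.cast_one, mul_comm]
    apply mul_le_mul <;> nlinarith
  constructor
  · have h5 : g * ((k.choose 2 : ℝ) + 1) * δ ≤ g * (k : ℝ) ^ 2 * δ := by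
      gcongr
      rw [hC]; nlinarith
    linarith
  · have h5 : (dim g k : ℝ) * δ ≤ g * (k : ℝ) ^ 2 * δ := by gcongr
    linarith

omit [NeZero g] in
lemma dim_pos (hg : 2 ≤ g) (hk : 2 ≤ k) : 0 < dim g k :=
  Nat.mul_pos (Nat.choose_pos hk) (by lia)

/-- Bounds for the contribution of one peak. -/
lemma integral_cube_bounds {δ : ℝ} (hδ : 0 < δ) (hs : (dim g k : ℝ) * δ ≤ 1 / 8) {t : ℕ}
    (ht : t * ((dim g k : ℝ) * δ) ^ 3 ≤ 2) :
    ‖∫ θ in cube g k δ, stepChar g k θ ^ t‖ ≤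
      (1 + 1 / 4 * ((dim g k : ℝ) * δ) ^ 6) ^ ((t : ℝ) / 2) *
        (1 + 1 / 3 * ((dim g k : ℝ) * δ) ^ 4) ^ t *
        ∫ θ in cube g k δ, Real.exp (-((t : ℝ) / 2) * (θ ⬝ᵥ (covMatrix g k).mulVec θ)) ∧
    (1 + (t : ℝ) ^ 2 * ((dim g k : ℝ) * δ) ^ 6) ^ (-(1 / 2) : ℝ) *
        (1 - 1 / 3 * ((dim g k : ℝ) * δ) ^ 4) ^ t *
        ∫ θ in cube g k δ, Real.exp (-((t : ℝ) / 2) * (θ ⬝ᵥ (covMatrix g k).mulVec θ)) ≤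
      (∫ θ in cube g k δ, stepChar g k θ ^ t).re := by
  have hs0 : 0 ≤ (dim g k : ℝ) * δ := by positivity
  have hcE : Continuous fun θ : Idx g k → ℝ =>
      Real.exp (-((t : ℝ) / 2) * (θ ⬝ᵥ (covMatrix g k).mulVec θ)) := by
    unfold dotProduct Matrix.mulVec dotProduct; fun_prop
  have hcF : Continuous fun θ => stepChar g k θ ^ t := continuous_stepChar.pow t
  have hiE := hcE.continuousOn.integrableOn_compact (isCompact_cube (g := g) (k := k) δ)
    (μ := volume)
  have hiF := hcF.continuousOn.integrableOn_compact (isCompact_cube (g := g) (k := k) δ)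
    (μ := volume)
  have hexp : ∀ θ : Idx g k → ℝ, Real.exp (-((t : ℝ) / 2) * (θ ⬝ᵥ (covMatrix g k).mulVec θ)) =
      Real.exp (-(t : ℝ) * (θ ⬝ᵥ (covMatrix g k).mulVec θ / 2)) := fun θ => by ring_nf
  constructor
  · rw [← integral_const_mul]
    refine (norm_integral_le_integral_norm _).trans
      (setIntegral_mono_on hiF.norm (hiE.const_mul _) (measurableSet_cube δ) fun θ hθ => ?_)
    obtain ⟨-, h2, h3, h4, h5⟩ := stepChar_near hθ hs
    rw [hexp]
    exact norm_pow_le_of_near hs0 hs (by linarith) h3 h4 h5 t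
  · have hre : (∫ θ in cube g k δ, stepChar g k θ ^ t).re =
        ∫ θ in cube g k δ, (stepChar g k θ ^ t).re := (integral_re hiF).symm
    rw [hre, ← integral_const_mul]
    refine setIntegral_mono_on (hiE.const_mul _) hiF.re (measurableSet_cube δ) fun θ hθ => ?_
    obtain ⟨h1, h2, h3, -, h5⟩ := stepChar_near hθ hs
    rw [hexp]
    exact le_re_pow_of_near hs0 hs (by linarith) (by linarith) h3 h5 ht

end Assembly

end DiffMatrixWalk

theorem mainTheorem2 (g : ℕ) [NeZero g] (hg : 2 ≤ g) :
    (∃ D₁ D₂ : ℝ, ∀ k : ℕ, DiffMatrixWalk.CubeConstants g k D₁ D₂) ∧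
    ∀ (k : ℕ) (_hk : 2 ≤ k) (D₁ D₂ : ℝ) (_hD : DiffMatrixWalk.CubeConstants g k D₁ D₂)
      {Ω : Type*} [MeasurableSpace Ω] (μ : MeasureTheory.Measure Ω)
      [MeasureTheory.IsProbabilityMeasure μ]
      (ξ : ℕ → Ω → DiffMatrixWalk.Idx g k → ℝ) (_hξ : DiffMatrixWalk.IsStepSequence g k μ ξ)
      (δ : ℝ) (_hδ : 0 < δ)
      (_hδ' : δ < 8 / 5 * (g : ℝ) ^ (-(k : ℤ) - 3) * (k : ℝ) ^ (-2 : ℤ))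
      (t : ℕ) (_ht : 0 < t) (_hgt : g ∣ t)
      (_htδ : (t : ℝ) < 2 * ((DiffMatrixWalk.dim g k : ℝ) * δ) ^ (-3 : ℤ))
      (_hpar : Odd g ∨ (Even g ∧ Even (t / g))),
      μ.real {ω | DiffMatrixWalk.walk ξ t ω = 0} ≤
          DiffMatrixWalk.mainTerm g k t * DiffMatrixWalk.upperFactor D₂ g k t δ +
            DiffMatrixWalk.errorTerm g k t δ ∧
        DiffMatrixWalk.mainTerm g k t * DiffMatrixWalk.lowerFactor D₁ g k t δ -
            DiffMatrixWalk.errorTerm g k t δ ≤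
          μ.real {ω | DiffMatrixWalk.walk ξ t ω = 0} := by
  open DiffMatrixWalk in
  refine ⟨exists_cubeConstants hg, ?_⟩
  intro k hk D₁ D₂ hD Ω _ μ _ ξ hξ δ hδ hδ' t ht hgt htδ hpar
  obtain ⟨hδ₁, hs⟩ := radius_bounds hg hk hδ hδ'
  have hs0 : 0 < (dim g k : ℝ) * δ := mul_pos (Nat.cast_pos.2 (dim_pos hg hk)) hδ
  have hts : t * ((dim g k : ℝ) * δ) ^ 3 ≤ 2 := by
    have h1 : (2 : ℝ) * ((dim g k : ℝ) * δ) ^ (-3 : ℤ) = 2 / ((dim g k : ℝ) * δ) ^ 3 := by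
      rw [zpow_neg, div_eq_mul_inv]; norm_cast
    rw [h1, lt_div_iff₀ (by positivity)] at htδ
    exact htδ.le
  have hF := prob_walk_eq_zero (by lia : 0 < k) hξ hgt
  have hbox := integral_box_sub_le (k := k) hg hδ hδ₁ hgt hpar
  rw [← hF, card_peakIndex (by lia)] at hbox
  obtain ⟨hup, hlow⟩ := integral_cube_bounds (g := g) hδ hs hts
  obtain ⟨hGlow, hGup⟩ := gaussian_integral_bounds hD hδ ht
  set p := μ.real {ω | walk ξ t ω = 0} with hp
  set I := ∫ θ in cube g k δ, stepChar g k θ ^ t with hI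
  set J := ∫ θ in cube g k δ, Real.exp (-((t : ℝ) / 2) * (θ ⬝ᵥ (covMatrix g k).mulVec θ)) with hJ
  set N : ℝ := (g : ℝ) ^ (k - 1).choose 2 with hN
  set s := (dim g k : ℝ) * δ with hs_def
  have hN0 : 0 ≤ N := by positivity
  -- The probability is real, so only the real part of the cube integral matters. The box has volume
  -- (2π)^d, so dividing by it leaves exactly `errorTerm`.
  have hre : |(2 * Real.pi) ^ dim g k * p - N * I.re| ≤
      (2 * Real.pi) ^ dim g k * errorTerm g k t δ := by
    refine le_trans ?_ hbox
    refine le_trans (le_of_eq ?_) (Complex.abs_re_le_norm _)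
    congr 1
    have h1 : ((2 * Real.pi : ℂ) ^ dim g k) * (p : ℂ) - ((g ^ (k - 1).choose 2 : ℕ) : ℂ) * I =
        (((2 * Real.pi) ^ dim g k * p : ℝ) : ℂ) - ((N : ℝ) : ℂ) * I := by
      rw [hN]; push_cast; rfl
    rw [h1, Complex.sub_re, Complex.ofReal_re, Complex.re_ofReal_mul]
  have hpi : (0 : ℝ) < (2 * Real.pi) ^ dim g k := by positivity
  have hre' := abs_le.1 hre
  constructor
  · refine le_of_mul_le_mul_left ?_ hpi
    set a := (1 + 1 / 4 * s ^ 6) ^ ((t : ℝ) / 2) * (1 + 1 / 3 * s ^ 4) ^ t with ha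
    have ha0 : 0 ≤ a := by positivity
    have h1 : N * I.re ≤ a * (N * J) := by
      calc N * I.re ≤ N * (a * J) :=
            mul_le_mul_of_nonneg_left ((Complex.re_le_norm I).trans hup) hN0
        _ = a * (N * J) := by ring
    have h2 := h1.trans (mul_le_mul_of_nonneg_left hGup ha0)
    have h3 : (2 * Real.pi) ^ dim g k * (mainTerm g k t * upperFactor D₂ g k t δ +
        errorTerm g k t δ) = a * ((2 * Real.pi) ^ dim g k * mainTerm g k t *
          (1 - Real.exp (-(t : ℝ) * (D₂ * δ) ^ 2)) ^ ((dim g k : ℝ) / 2)) +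
        (2 * Real.pi) ^ dim g k * errorTerm g k t δ := by
      rw [upperFactor, ha, hs_def]; ring
    rw [h3]
    linarith [hre'.2]
  · refine le_of_mul_le_mul_left ?_ hpi
    set a := (1 + (t : ℝ) ^ 2 * s ^ 6) ^ (-(1 / 2) : ℝ) * (1 - 1 / 3 * s ^ 4) ^ t with ha
    have ha0 : 0 ≤ a := by
      have h4 : s ^ 4 ≤ 1 := pow_le_one₀ hs0.le (by linarith)
      have h5 : 0 ≤ 1 - 1 / 3 * s ^ 4 := by linarith
      positivity
    have h1 : a * (N * J) ≤ N * I.re := by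
      calc a * (N * J) = N * (a * J) := by ring
        _ ≤ N * I.re := mul_le_mul_of_nonneg_left hlow hN0
    have h2 := (mul_le_mul_of_nonneg_left hGlow ha0).trans h1
    have h3 : (2 * Real.pi) ^ dim g k * (mainTerm g k t * lowerFactor D₁ g k t δ -
        errorTerm g k t δ) = a * ((2 * Real.pi) ^ dim g k * mainTerm g k t *
          (1 - Real.exp (-((t : ℝ) / 2) * (D₁ * δ) ^ 2)) ^ ((dim g k : ℝ) / 2)) -
        (2 * Real.pi) ^ dim g k * errorTerm g k t δ := by
      rw [lowerFactor, ha, hs_def]; ring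
    rw [h3]
    linarith [hre'.1]
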